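/- Let $-\infty\le a<b\le\infty$ and let $p,q,r$ be real-valued Lebesgue measurable functions on $(a,b)$ with $p,r>0$ a.e. and $r,\,1/p,\,q\in L^1_{loc}((a,b);dx)$. For $y\in AC_{loc}((a,b))$ write $y^{[1]}=p\,y'$, and set $$\tau=\frac1r\Big[-\frac{d}{dx}\,p\,\frac{d}{dx}+q\Big]$$ on $(a,b)$. In the complex Hilbert space $L^2_r:=L^2((a,b);r\,dx)$ define the maximal operator $T_{max}f=\tau f$ on $$\mathcal D(T_{max})=\{g\in L^2_r : g,\,g^{[1]}\in AC_{loc}((a,b)),\ \tau g\in L^2_r\},$$ the preminimal operator $T_{min,0}$ as the restriction of $T_{max}$ to those $g\in\mathcal D(T_{max})$ whose support is a compact subset of $(a,b)$, and the minimal operator $T_{min}=\overline{T_{min,0}}$. Let $[a,b]$ denote the set of real $x$ with $a\le x\le b$ (so infinite endpoints are not included). Let $A$ be a real-valued function with $A,\,A^{[1]}\in AC([a,b])$ (understood as $AC_{loc}$ near an infinite endpoint), let $\phi\in C^2([a,b])$ be real-valued with $\phi'(x)\ne0$ for all $x\in[a,b]$, and let $\phi$ fix the endpoints: $\phi(d)=d$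 for $d\in\{a,b\}$, where for an infinite endpoint this means $\phi(x)\to d$ as $x\to d$. Suppose that $A\neq 0$ on $(a,b)$, that $A^2/\phi'$ and $\phi'/A^2$ are bounded above on $(a,b)$, and that for some constant $C>0$ and a.e. $x\in(a,b)$ \begin{align*} r(x)&=C\,r(\phi^{-1}(x)),\\ p(x)&=[A(\phi^{-1}(x))]^2\,\phi'(\phi^{-1}(x))\,p(\phi^{-1}(x)),\\ q(x)&=\frac{A(\phi^{-1}(x))}{\phi'(\phi^{-1}(x))}\Big\{A(\phi^{-1}(x))\,q(\phi^{-1}(x))-\big(A^{[1]}\big)'(\phi^{-1}(x))\Big\}. \end{align*} Then $(Kf)(x)=A(x)f(\phi(x))$ defines a bounded and boundedly invertible operator $K$ in $L^2_r$, and $T_{min,0}$, $T_{min}$ and $T_{max}$ are all $K$-invariant: each of these operators $T$ is densely defined and closable, and $K^*TK=T$, that is, $\{f\in L^2_r: Kf\in\mathcal D(T)\}=\mathcal D(T)$ and $K^*TKf=Tf$ for all $f\in\mathcal D(T)$. -/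

import Mathlib

open MeasureTheory Filter Set
open scoped ENNReal Topology

noncomputable section

namespace SturmLiouville

/-! ### `K`-invariance of an unbounded operator -/

section Abstract

variable {H : Type*} [NormedAddCommGroup H] [InnerProductSpace ℂ H] [CompleteSpace H]

/-- The operator `K* T K` with its natural domain `{f | K f ∈ D(T)}`. -/
def conjOp (K : H →L[ℂ] H) (T : H →ₗ.[ℂ] H) : H →ₗ.[ℂ] H where
  domain := T.domain.comap (K : H →ₗ[ℂ] H)
  toFun := (ContinuousLinearMap.adjoint K : H →ₗ[ℂ] H) ∘ₗ T.toFun ∘ₗ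
    ((K : H →ₗ[ℂ] H).restrict (p := T.domain.comap (K : H →ₗ[ℂ] H)) (q := T.domain)
      (fun _ hx => hx))

/-- `T` is `K`-invariant: `K` is bounded and boundedly invertible, `T` is densely defined and
closable, and `K* T K = T` as unbounded operators (equal domains and equal action). -/
structure KInvariant (K : H →L[ℂ] H) (T : H →ₗ.[ℂ] H) : Prop where
  isUnit : IsUnit K
  dense_domain : Dense (T.domain : Set H)
  isClosable : T.IsClosable
  conj_eq : conjOp K T = T

end Abstract

/-! ### Intervals and absolute continuity -/

/-- The open interval `(a, b)` of real numbers with possibly infinite endpoints. -/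
def openI (a b : EReal) : Set ℝ := {x | a < (x : EReal) ∧ (x : EReal) < b}

/-- The set `[a, b] ∩ ℝ`: finite endpoints belong to it, infinite ones do not. -/
def closedI (a b : EReal) : Set ℝ := {x | a ≤ (x : EReal) ∧ (x : EReal) ≤ b}

/-- `f` is absolutely continuous on every compact interval `[c, d]` with `c, d ∈ s`. For
`s = openI a b` this is `AC_loc((a, b))`; for `s = closedI a b` this is `AC([a, b])`, with `AC_loc`
near infinite endpoints. -/
def ACLoc {E : Type*} [NormedAddCommGroup E] (s : Set ℝ) (f : ℝ → E) : Prop :=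
  ∀ c ∈ s, ∀ d ∈ s, AbsolutelyContinuousOnInterval f c d

/-- `y₁` is (a representative of) the quasi-derivative `p y'` of `y` on `(a, b)`. -/
def IsQuasiDeriv {E : Type*} [NormedAddCommGroup E] [NormedSpace ℝ E] (a b : EReal)
    (p : ℝ → ℝ) (y y₁ : ℝ → E) : Prop :=
  ∀ᵐ x ∂(volume.restrict (openI a b)), y₁ x = p x • deriv y x

/-! ### The Sturm–Liouville operators -/

/-- The standing assumptions on the coefficients of
`τ = (1 / r) [-(d/dx) p (d/dx) + q]` on `(a, b)`. -/
structure IsCoefficients (a b : EReal) (p q r : ℝ → ℝ) : Prop where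
  lt : a < b
  aemeasurable_p : AEMeasurable p (volume.restrict (openI a b))
  aemeasurable_q : AEMeasurable q (volume.restrict (openI a b))
  aemeasurable_r : AEMeasurable r (volume.restrict (openI a b))
  p_pos : ∀ᵐ x ∂(volume.restrict (openI a b)), 0 < p x
  r_pos : ∀ᵐ x ∂(volume.restrict (openI a b)), 0 < r x
  locInt_r : LocallyIntegrableOn r (openI a b)
  locInt_inv_p : LocallyIntegrableOn (fun x => 1 / p x) (openI a b)
  locInt_q : LocallyIntegrableOn q (openI a b)

/-- The measure `r dx` on `(a, b)`. -/
def weight (a b : EReal) (r : ℝ → ℝ) : Measure ℝ :=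
  (volume.restrict (openI a b)).withDensity (fun x => ENNReal.ofReal (r x))

/-- The complex Hilbert space `L²((a, b); r dx)`. -/
abbrev L2 (a b : EReal) (r : ℝ → ℝ) : Type := Lp ℂ 2 (weight a b r)

/-- `f` and `g` are elements of `L²((a, b); r dx)` such that `f, f^{[1]} ∈ AC_loc((a, b))` and
`g = τ f`. -/
def TauRel (a b : EReal) (p q r : ℝ → ℝ) (f g : L2 a b r) : Prop :=
  ∃ y y₁ : ℝ → ℂ, f =ᵐ[weight a b r] y ∧ ACLoc (openI a b) y ∧ ACLoc (openI a b) y₁ ∧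
    IsQuasiDeriv a b p y y₁ ∧
    g =ᵐ[weight a b r] fun x => (1 / r x) • (-deriv y₁ x + q x • y x)

lemma ordConnected_openI (a b : EReal) : (openI a b).OrdConnected := by
  refine ⟨fun x hx y hy z hz => ⟨lt_of_lt_of_le hx.1 ?_, lt_of_le_of_lt ?_ hy.2⟩⟩
  · exact_mod_cast hz.1
  · exact_mod_cast hz.2

lemma isOpen_openI (a b : EReal) : IsOpen (openI a b) :=
  (isOpen_Ioi.preimage continuous_coe_real_ereal).inter
    (isOpen_Iio.preimage continuous_coe_real_ereal)

lemma ae_restrict_openI_of_rat {a b : EReal} {P : ℝ → Prop}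
    (h : ∀ c ∈ openI a b, ∀ d ∈ openI a b, ∀ᵐ x, x ∈ uIcc c d → P x) :
    ∀ᵐ x ∂(volume.restrict (openI a b)), P x := by
  rw [ae_restrict_iff' (isOpen_openI a b).measurableSet]
  have h2 : ∀ c d : ℚ, ∀ᵐ x : ℝ, (c : ℝ) ∈ openI a b → (d : ℝ) ∈ openI a b →
      x ∈ uIcc (c : ℝ) d → P x := by
    intro c d
    by_cases hc : (c : ℝ) ∈ openI a b
    · by_cases hd : (d : ℝ) ∈ openI a b
      · filter_upwards [h c hc d hd] with x hx _ _ using hx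
      · simp [hd]
    · simp [hc]
  filter_upwards [ae_all_iff.2 fun c => ae_all_iff.2 (h2 c)] with x hx hxI
  obtain ⟨ε, hε, hb⟩ := Metric.isOpen_iff.1 (isOpen_openI a b) x hxI
  obtain ⟨c, hc1, hc2⟩ := exists_rat_btwn (show x - ε < x by linarith)
  obtain ⟨d, hd1, hd2⟩ := exists_rat_btwn (show x < x + ε by linarith)
  refine hx c d (hb ?_) (hb ?_) ?_
  · rw [Real.ball_eq_Ioo]; exact ⟨hc1, by linarith⟩
  · rw [Real.ball_eq_Ioo]; exact ⟨by linarith, hd2⟩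
  · exact Icc_subset_uIcc ⟨hc2.le, hd1.le⟩

lemma ACLoc.ae_differentiableAt {a b : EReal} {y : ℝ → ℂ} (h : ACLoc (openI a b) y) :
    ∀ᵐ x ∂(volume.restrict (openI a b)), DifferentiableAt ℝ y x :=
  ae_restrict_openI_of_rat fun c hc d hd => 
    BoundedVariationOn.ae_differentiableAt_of_mem_uIcc (h c hc d hd).boundedVariationOn

lemma ACLoc.continuousOn {a b : EReal} {y : ℝ → ℂ} (h : ACLoc (openI a b) y) :
    ContinuousOn y (openI a b) := by
  intro x hxI
  obtain ⟨ε, hε, hb⟩ := Metric.isOpen_iff.1 (isOpen_openI a b) x hxI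
  have hc : x - ε / 2 ∈ openI a b := hb (by rw [Real.ball_eq_Ioo]; constructor <;> linarith)
  have hd : x + ε / 2 ∈ openI a b := hb (by rw [Real.ball_eq_Ioo]; constructor <;> linarith)
  have := (h _ hc _ hd).continuousOn
  rw [uIcc_of_le (by linarith)] at this
  exact (this.continuousAt (Icc_mem_nhds (by linarith) (by linarith))).continuousWithinAt

/-- The relation `g = τ f` as a linear subspace of `L² × L²`. -/
def maxGraph (a b : EReal) (p q r : ℝ → ℝ) : Submodule ℂ (L2 a b r × L2 a b r) where
  carrier := {z | TauRel a b p q r z.1 z.2}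
  zero_mem' := by
    refine ⟨0, 0, Lp.coeFn_zero _ _ _, ?_, ?_, ?_, ?_⟩
    · exact fun c _ d _ =>
        (LipschitzWith.const (0 : ℂ)).lipschitzOnWith.absolutelyContinuousOnInterval
    · exact fun c _ d _ =>
        (LipschitzWith.const (0 : ℂ)).lipschitzOnWith.absolutelyContinuousOnInterval
    · exact Eventually.of_forall fun x => by
        have h0 : deriv (0 : ℝ → ℂ) x = 0 := deriv_const x (0 : ℂ)
        simp [h0]
    · filter_upwards [Lp.coeFn_zero ℂ 2 (weight a b r)] with x hx
      have h0 : deriv (0 : ℝ → ℂ) x = 0 := deriv_const x (0 : ℂ)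
      simpa [h0] using hx
  add_mem' := by
    rintro ⟨f, g⟩ ⟨f', g'⟩ ⟨y, y₁, hf, hy, hy₁, hq, hg⟩ ⟨z, z₁, hf', hz, hz₁, hq', hg'⟩
    refine ⟨y + z, y₁ + z₁, ?_, ?_, ?_, ?_, ?_⟩
    · filter_upwards [hf, hf', Lp.coeFn_add f f'] with x h1 h2 h3
      exact h3.trans (by rw [Pi.add_apply, Pi.add_apply]; exact congrArg₂ (· + ·) h1 h2)
    · exact fun c hc d hd => (hy c hc d hd).add (hz c hc d hd)
    · exact fun c hc d hd => (hy₁ c hc d hd).add (hz₁ c hc d hd)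
    · filter_upwards [hq, hq', hy.ae_differentiableAt, hz.ae_differentiableAt] with x h1 h2 h3 h4
      rw [deriv_add h3 h4, Pi.add_apply, h1, h2, smul_add]
    · have hac : weight a b r ≪ volume.restrict (openI a b) := withDensity_absolutelyContinuous _ _
      filter_upwards [hg, hg', Lp.coeFn_add g g', hac.ae_le hy₁.ae_differentiableAt,
        hac.ae_le hz₁.ae_differentiableAt] with x h1 h2 h3 h4 h5
      change (g + g') x = _
      rw [h3, deriv_add h4 h5, Pi.add_apply, h1, h2, Pi.add_apply, ← smul_add]
      congr 1
      rw [smul_add]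
      abel
  smul_mem' := by
    rintro k ⟨f, g⟩ ⟨y, y₁, hf, hy, hy₁, hq, hg⟩
    refine ⟨k • y, k • y₁, ?_, ?_, ?_, ?_, ?_⟩
    · filter_upwards [hf, Lp.coeFn_smul k f] with x h1 h3
      change (k • f) x = _
      simp [h3, h1]
    · exact fun c hc d hd => (hy c hc d hd).const_smul k
    · exact fun c hc d hd => (hy₁ c hc d hd).const_smul k
    · filter_upwards [hq] with x h1
      rw [deriv_const_smul_field, Pi.smul_apply, h1, smul_comm]
    · filter_upwards [hg, Lp.coeFn_smul k g] with x h1 h3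
      change (k • g) x = _
      rw [h3, deriv_const_smul_field, Pi.smul_apply, h1, Pi.smul_apply, smul_comm k (1 / r x),
        smul_comm (q x) k, smul_add, smul_neg]

lemma eqOn_zero_of_ae {a b : EReal} {y : ℝ → ℂ} (hy : ContinuousOn y (openI a b))
    (h : ∀ᵐ x ∂(volume.restrict (openI a b)), y x = 0) : EqOn y 0 (openI a b) :=
  Measure.eqOn_open_of_ae_eq (μ := volume) h (isOpen_openI a b) hy continuousOn_const

/-- `τ f` is uniquely determined by `f`, so that `maxGraph` really is the graph of an operator. -/
lemma maxGraph_functional {a b : EReal} {p q r : ℝ → ℝ} (h : IsCoefficients a b p q r) :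
    ∀ z : L2 a b r × L2 a b r, z ∈ maxGraph a b p q r → z.1 = 0 → z.2 = 0 := by
  rintro ⟨f, g⟩ ⟨y, y₁, hf, hy, hy₁, hq, hg⟩ (rfl : f = 0)
  have hac : volume.restrict (openI a b) ≪ weight a b r :=
    withDensity_absolutelyContinuous' h.aemeasurable_r.ennreal_ofReal
      (h.r_pos.mono fun x hx => by simpa using hx)
  have hac' : weight a b r ≪ volume.restrict (openI a b) := withDensity_absolutelyContinuous _ _
  have key : ∀ w : ℝ → ℂ, EqOn w 0 (openI a b) → ∀ x ∈ openI a b, deriv w x = 0 := by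
    intro w hw x hx
    have : w =ᶠ[𝓝 x] fun _ => (0 : ℂ) := hw.eventuallyEq_of_mem ((isOpen_openI a b).mem_nhds hx)
    rw [this.deriv_eq, deriv_const]
  have hy0 : EqOn y 0 (openI a b) := eqOn_zero_of_ae hy.continuousOn <| by
    filter_upwards [hac.ae_le hf, hac.ae_le (Lp.coeFn_zero ℂ 2 (weight a b r))] with x h1 h2
    rw [← h1]; exact h2
  have hmem := ae_restrict_mem (μ := volume) (isOpen_openI a b).measurableSet
  have hy₁0 : EqOn y₁ 0 (openI a b) := eqOn_zero_of_ae hy₁.continuousOn <| by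
    filter_upwards [hq, hmem] with x h1 h2
    rw [h1, key y hy0 x h2, smul_zero]
  refine Lp.ext ?_
  filter_upwards [hg, Lp.coeFn_zero ℂ 2 (weight a b r), hac'.ae_le hmem] with x h1 h2 h3
  rw [h1, h2, key y₁ hy₁0 x h3, hy0 h3]
  simp

/-- The maximal operator: `T_max f = τ f` on
`{f ∈ L² | f, f^{[1]} ∈ AC_loc((a, b)), τ f ∈ L²}`. -/
def Tmax (a b : EReal) (p q r : ℝ → ℝ) : L2 a b r →ₗ.[ℂ] L2 a b r :=
  (maxGraph a b p q r).toLinearPMap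

/-- The defining property of `T_max`: `f ∈ D(T_max)` and `T_max f = g` iff `g = τ f`. -/
lemma mem_graph_Tmax {a b : EReal} {p q r : ℝ → ℝ} (h : IsCoefficients a b p q r)
    (f g : L2 a b r) : (f, g) ∈ (Tmax a b p q r).graph ↔ TauRel a b p q r f g := by
  rw [Tmax, Submodule.toLinearPMap_graph_eq _ (maxGraph_functional h)]
  rfl

/-- The elements of `L²((a, b); r dx)` whose (essential) support is a compact subset of `(a, b)`. -/
def compactlySupported (a b : EReal) (r : ℝ → ℝ) : Submodule ℂ (L2 a b r) where
  carrier := {f | ∃ S : Set ℝ, IsCompact S ∧ S ⊆ openI a b ∧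
    ∀ᵐ x ∂(weight a b r), x ∉ S → f x = 0}
  zero_mem' := ⟨∅, isCompact_empty, empty_subset _, by
    filter_upwards [Lp.coeFn_zero ℂ 2 (weight a b r)] with x hx _ using hx⟩
  add_mem' := by
    rintro f g ⟨S, hS, hSI, hf⟩ ⟨S', hS', hSI', hg⟩
    refine ⟨S ∪ S', hS.union hS', union_subset hSI hSI', ?_⟩
    filter_upwards [hf, hg, Lp.coeFn_add f g] with x h1 h2 h3 hx
    rw [h3, Pi.add_apply, h1 fun h => hx (Or.inl h), h2 fun h => hx (Or.inr h), add_zero]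
  smul_mem' := by
    rintro k f ⟨S, hS, hSI, hf⟩
    refine ⟨S, hS, hSI, ?_⟩
    filter_upwards [hf, Lp.coeFn_smul k f] with x h1 h3 hx
    rw [h3, Pi.smul_apply, h1 hx, smul_zero]

/-- The preminimal operator: the restriction of `T_max` to the functions in `D(T_max)` that have
compact support in `(a, b)`. -/
def Tmin0 (a b : EReal) (p q r : ℝ → ℝ) : L2 a b r →ₗ.[ℂ] L2 a b r :=
  (Tmax a b p q r).domRestrict (compactlySupported a b r)

/-- The minimal operator: the closure of the preminimal operator. -/
def Tmin (a b : EReal) (p q r : ℝ → ℝ) : L2 a b r →ₗ.[ℂ] L2 a b r :=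
  (Tmin0 a b p q r).closure

/-! ### The operator `K` and the assumptions on `A` and `φ` -/

/-- `K` is the operator `(K f)(x) = A(x) f(φ(x))` in `L²((a, b); r dx)`. -/
def IsWeightedComposition {a b : EReal} {r : ℝ → ℝ} (A φ : ℝ → ℝ)
    (K : L2 a b r →L[ℂ] L2 a b r) : Prop :=
  ∀ f : L2 a b r, K f =ᵐ[weight a b r] fun x => A x • f (φ x)

/-- `φ(d) = d` for `d ∈ {a, b}`, read as a limit at an infinite endpoint. -/
def FixesEndpoints (a b : EReal) (φ : ℝ → ℝ) : Prop :=
  (∀ d : ℝ, (d : EReal) = a ∨ (d : EReal) = b → φ d = d) ∧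
    (a = ⊥ → Tendsto φ atBot atBot) ∧ (b = ⊤ → Tendsto φ atTop atTop)

/-- The assumptions on `A`, its quasi-derivative `A₁ = A^{[1]} = p A'`, and `φ`. The bounds are
those of `A² / φ'` and `φ' / A²` on `(a, b)`; the second quotient requires `A ≠ 0` there. -/
structure IsTransformation (a b : EReal) (p A A₁ φ : ℝ → ℝ) : Prop where
  ac_A : ACLoc (closedI a b) A
  ac_A₁ : ACLoc (closedI a b) A₁
  quasiDeriv : IsQuasiDeriv a b p A A₁
  contDiffOn : ContDiffOn ℝ 2 φ (closedI a b)
  deriv_ne_zero : ∀ x ∈ closedI a b, derivWithin φ (closedI a b) x ≠ 0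
  fixes : FixesEndpoints a b φ
  A_ne_zero : ∀ x ∈ openI a b, A x ≠ 0
  bdd : BddAbove ((fun x => A x ^ 2 / deriv φ x) '' openI a b)
  bdd_inv : BddAbove ((fun x => deriv φ x / A x ^ 2) '' openI a b)

/-- The inverse of `φ : (a, b) → (a, b)`. -/
def phiInv (a b : EReal) (φ : ℝ → ℝ) : ℝ → ℝ := Function.invFunOn φ (openI a b)

/-- The functional equations, for a.e. `x ∈ (a, b)`:
`r = C r ∘ φ⁻¹`, `p = (A ∘ φ⁻¹)² (φ' ∘ φ⁻¹) (p ∘ φ⁻¹)`, and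
`q = ((A / φ') ∘ φ⁻¹) ((A q - (A^{[1]})') ∘ φ⁻¹)`. -/
structure FunctionalEquations (a b : EReal) (p q r A A₁ φ : ℝ → ℝ) (C : ℝ) : Prop where
  eq_r : ∀ᵐ x ∂(volume.restrict (openI a b)), r x = C * r (phiInv a b φ x)
  eq_p : ∀ᵐ x ∂(volume.restrict (openI a b)),
    p x = A (phiInv a b φ x) ^ 2 * deriv φ (phiInv a b φ x) * p (phiInv a b φ x)
  eq_q : ∀ᵐ x ∂(volume.restrict (openI a b)),
    q x = A (phiInv a b φ x) / deriv φ (phiInv a b φ x) *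
      (A (phiInv a b φ x) * q (phiInv a b φ x) - deriv A₁ (phiInv a b φ x))

end SturmLiouville

end

open scoped NNReal InnerProductSpace

/-! ### Stability and calculus of absolutely continuous functions. -/

namespace AbsolutelyContinuousOnInterval

/-! Let `J` be the weighted composition `g ↦ (C φ' / A) (g ∘ φ)`. The substitution `φ` together with
`r ∘ φ = C r` gives `K* J = 1`. The equations for `p`, `q` and `r` amount to the intertwining `τ (K
y) = J (τ y)`, with `(K y)^{[1]} = A^{[1]} (y ∘ φ) + A⁻¹ (y^{[1]} ∘ φ)`: this is
`IsSymmetry.tauRel_map`. Hence `K × J` maps the graph of `T_max` into itself. It also preserves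
compact supports, hence the graph of `T_min,0`, and by continuity the closure of that graph.

The inverse transformation, with `ψ = φ⁻¹`, `1 / (A ∘ ψ)` and `1 / C`, satisfies the same hypotheses
(`IsSymmetry.symm`). So `K⁻¹` comes with a companion that also preserves the graphs, and
`conjOp_eq_of_graph_maps` turns the two inclusions into `K* T K = T`. That `φ` is an increasing
diffeomorphism of `(a, b)` follows from `φ' ≠ 0` and the fixed endpoints
(`IsTransformation.isDiffeo`).

It remains to see that the operators are densely defined and closable. Lagrange's identity without
boundary terms makes `T_max` a restriction of the adjoint of `T_min,0`, which is closed once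
`T_min,0` is densely defined. Density (`dense_domain_Tmin0`) is local: if `g` is orthogonal to the
domain, then on a short interval a solution of `τ u = g` is orthogonal to everything orthogonal to
the two-dimensional space of solutions of `τ v = 0`. So `u` lies in that space, and `g = τ u = 0`
there. -/

theorem lipschitzOn_comp {X Y : Type*} [PseudoMetricSpace X] [PseudoMetricSpace Y] {f : ℝ → X}
    {g : X → Y} {K : ℝ≥0} {c d : ℝ} (hf : AbsolutelyContinuousOnInterval f c d)
    (hg : LipschitzOnWith K g (f '' uIcc c d)) :
    AbsolutelyContinuousOnInterval (fun x => g (f x)) c d := by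
  have h0 : Tendsto (fun E : ℕ × (ℕ → ℝ × ℝ) =>
      (K : ℝ) * ∑ i ∈ Finset.range E.1, dist (f (E.2 i).1) (f (E.2 i).2))
      (totalLengthFilter ⊓ 𝓟 (disjWithin c d)) (𝓝 0) := by
    simpa using Tendsto.const_mul (K : ℝ) hf
  refine squeeze_zero' (Eventually.of_forall fun _ => Finset.sum_nonneg fun _ _ => dist_nonneg)
    ?_ h0
  rw [eventually_inf_principal]
  filter_upwards with E hE
  rw [Finset.mul_sum]
  exact Finset.sum_le_sum fun i hi =>
    hg.dist_le_mul _ (mem_image_of_mem _ (hE.1 i hi).1) _ (mem_image_of_mem _ (hE.1 i hi).2)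

theorem comp_monotoneOn {X : Type*} [PseudoMetricSpace X] {f : ℝ → X} {φ : ℝ → ℝ} {c d : ℝ}
    (hf : AbsolutelyContinuousOnInterval f (φ c) (φ d)) (hm : MonotoneOn φ (uIcc c d))
    (hφ : AbsolutelyContinuousOnInterval φ c d) :
    AbsolutelyContinuousOnInterval (fun x => f (φ x)) c d := by
  rw [absolutelyContinuousOnInterval_iff] at hf hφ ⊢
  intro ε hε
  obtain ⟨δ, hδ, h1⟩ := hf ε hε
  obtain ⟨η, hη, h2⟩ := hφ δ hδ
  refine ⟨η, hη, fun E hE hlen => ?_⟩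
  refine h1 (E.1, fun i => (φ (E.2 i).1, φ (E.2 i).2)) ⟨fun i hi => ?_, ?_⟩ (h2 E hE hlen)
  · have := fun x (hx : x ∈ uIcc c d) => hm.mapsTo_uIcc hx
    exact ⟨this _ (hE.1 i hi).1, this _ (hE.1 i hi).2⟩
  · intro i hi j hj hij
    have hd := hE.2 hi hj hij
    obtain ⟨hi1, hi2⟩ := hE.1 i hi
    obtain ⟨hj1, hj2⟩ := hE.1 j hj
    simp only [Function.onFun, uIoc, Ioc_disjoint_Ioc] at hd ⊢
    have hmin : ∀ {x y}, x ∈ uIcc c d → y ∈ uIcc c d → min x y ∈ uIcc c d := by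
      intro x y hx hy; rcases min_choice x y with h | h <;> rw [h] <;> assumption
    have hmax : ∀ {x y}, x ∈ uIcc c d → y ∈ uIcc c d → max x y ∈ uIcc c d := by
      intro x y hx hy; rcases max_choice x y with h | h <;> rw [h] <;> assumption
    -- Disjointness of half-open intervals is an inequality between a min of right ends and a max of
    -- left ends. A monotone map commutes with both, so the inequality survives even if `φ` is not
    -- injective.
    rw [← hm.map_max hi1 hi2, ← hm.map_max hj1 hj2, ← hm.map_min hi1 hi2, ← hm.map_min hj1 hj2,
      ← hm.map_min (hmax hi1 hi2) (hmax hj1 hj2), ← hm.map_max (hmin hi1 hi2) (hmin hj1 hj2)]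
    exact hm (hmin (hmax hi1 hi2) (hmax hj1 hj2)) (hmax (hmin hi1 hi2) (hmin hj1 hj2)) hd

theorem inv_of_ne_zero {f : ℝ → ℝ} {c d : ℝ} (hf : AbsolutelyContinuousOnInterval f c d)
    (h0 : ∀ x ∈ uIcc c d, f x ≠ 0) : AbsolutelyContinuousOnInterval (fun x => (f x)⁻¹) c d := by
  obtain ⟨M, hM⟩ := isCompact_uIcc.exists_bound_of_continuousOn (hf.continuousOn.inv₀ h0)
  have hM0 : 0 ≤ M := (norm_nonneg _).trans (hM c left_mem_uIcc)
  -- If `|1 / f| ≤ M`, then `1/s - 1/t = (t - s) / (s t)` makes inversion `M²`-Lipschitz on the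
  -- range of `f`.
  refine hf.lipschitzOn_comp (g := fun x => x⁻¹) (K := ⟨M * M, by positivity⟩)
    (LipschitzOnWith.of_dist_le_mul ?_)
  rintro _ ⟨x, hx, rfl⟩ _ ⟨y, hy, rfl⟩
  have hx0 := h0 x hx
  have hy0 := h0 y hy
  have : (f x)⁻¹ - (f y)⁻¹ = (f x)⁻¹ * (f y)⁻¹ * (f y - f x) := by field_simp
  rw [dist_eq_norm, this, norm_mul, norm_mul, dist_comm, dist_eq_norm]
  exact mul_le_mul_of_nonneg_right
    (mul_le_mul (hM x hx) (hM y hy) (norm_nonneg _) hM0) (norm_nonneg _)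

theorem ofReal {f : ℝ → ℝ} {c d : ℝ} (hf : AbsolutelyContinuousOnInterval f c d) :
    AbsolutelyContinuousOnInterval (fun x => (f x : ℂ)) c d :=
  hf.lipschitzOn_comp (Complex.isometry_ofReal.lipschitz.lipschitzOnWith)

theorem re {f : ℝ → ℂ} {c d : ℝ} (hf : AbsolutelyContinuousOnInterval f c d) :
    AbsolutelyContinuousOnInterval (fun x => (f x).re) c d :=
  hf.lipschitzOn_comp (g := Complex.re) (Complex.reCLM.lipschitz.lipschitzOnWith)

theorem im {f : ℝ → ℂ} {c d : ℝ} (hf : AbsolutelyContinuousOnInterval f c d) :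
    AbsolutelyContinuousOnInterval (fun x => (f x).im) c d :=
  hf.lipschitzOn_comp (g := Complex.im) (Complex.imCLM.lipschitz.lipschitzOnWith)

theorem conj {f : ℝ → ℂ} {c d : ℝ} (hf : AbsolutelyContinuousOnInterval f c d) :
    AbsolutelyContinuousOnInterval (fun x => starRingEnd ℂ (f x)) c d :=
  hf.lipschitzOn_comp (g := starRingEnd ℂ) (Complex.isometry_conj.lipschitz.lipschitzOnWith)

theorem intervalIntegral_eq_sub {f f' : ℝ → ℂ} {c d : ℝ}
    (hf : AbsolutelyContinuousOnInterval f c d)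
    (h : ∀ᵐ x, x ∈ uIcc c d → HasDerivAt f (f' x) x) :
    IntervalIntegrable f' volume c d ∧ ∫ x in c..d, f' x = f d - f c := by
  have hre : ∀ᵐ x, x ∈ uIoc c d → deriv (fun x => (f x).re) x = (f' x).re := by
    filter_upwards [h] with x hx hxm
    exact (Complex.reCLM.hasFDerivAt.comp_hasDerivAt x (hx (uIoc_subset_uIcc hxm))).deriv
  have him : ∀ᵐ x, x ∈ uIoc c d → deriv (fun x => (f x).im) x = (f' x).im := by
    filter_upwards [h] with x hx hxm
    exact (Complex.imCLM.hasFDerivAt.comp_hasDerivAt x (hx (uIoc_subset_uIcc hxm))).deriv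
  have ire : IntervalIntegrable (fun x => (f' x).re) volume c d :=
    hf.re.intervalIntegrable_deriv.congr_ae ((ae_restrict_iff' measurableSet_uIoc).2 hre)
  have iim : IntervalIntegrable (fun x => (f' x).im) volume c d :=
    hf.im.intervalIntegrable_deriv.congr_ae ((ae_restrict_iff' measurableSet_uIoc).2 him)
  have hint : IntervalIntegrable f' volume c d := by
    rw [intervalIntegrable_iff] at ire iim ⊢
    have := (ire.ofReal (𝕜 := ℂ)).add ((iim.ofReal (𝕜 := ℂ)).mul_const Complex.I)
    refine this.congr (Eventually.of_forall fun x => ?_)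
    simp
  refine ⟨hint, ?_⟩
  have h1 : (∫ x in c..d, f' x).re = (f d).re - (f c).re := by
    rw [← hf.re.integral_deriv_eq_sub, intervalIntegral.integral_congr_ae hre]
    exact (Complex.reCLM.intervalIntegral_comp_comm hint).symm
  have h2 : (∫ x in c..d, f' x).im = (f d).im - (f c).im := by
    rw [← hf.im.integral_deriv_eq_sub, intervalIntegral.integral_congr_ae him]
    exact (Complex.imCLM.intervalIntegral_comp_comm hint).symm
  exact Complex.ext (by simpa using h1) (by simpa using h2)

end AbsolutelyContinuousOnInterval

theorem MeasureTheory.Integrable.absolutelyContinuousOnInterval_primitive {f : ℝ → ℂ}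
    (hf : Integrable f) (e c d : ℝ) :
    AbsolutelyContinuousOnInterval (fun x => ∫ t in e..x, f t) c d := by
  have key : ∀ g : ℝ → ℝ, Integrable g →
      AbsolutelyContinuousOnInterval (fun x => ∫ t in e..x, g t) c d := by
    intro g hg
    -- This interval contains `c`, `d` and the base point `e`, which need not lie between `c` and
    -- `d`.
    have h1 := (hg.intervalIntegrable (a := min e (min c d)) (b := max e (max c d)))
    refine (h1.absolutelyContinuousOnInterval_intervalIntegral (c := e) ?_).mono ?_
    · rw [uIcc_of_le (by simp)]; simp
    · rw [uIcc_of_le (a := min e (min c d)) (by simp)]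
      exact Icc_subset_Icc (by simp) (by simp)
  have h := (key _ hf.re).ofReal.fun_add ((key _ hf.im).ofReal.const_smul Complex.I)
  convert! h using 1
  funext x
  have h1 := Complex.reCLM.intervalIntegral_comp_comm (hf.intervalIntegrable (a := e) (b := x))
  have h2 := Complex.imCLM.intervalIntegral_comp_comm (hf.intervalIntegrable (a := e) (b := x))
  simp only [Complex.reCLM_apply, Complex.imCLM_apply] at h1 h2
  simp only [RCLike.re_to_complex, RCLike.im_to_complex, h1, h2, smul_eq_mul]
  rw [mul_comm, Complex.re_add_im]

/-! ### The first-order system: Lagrange's identity and existence of solutions. -/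

namespace SturmLiouville

/-- `(y, y₁)` is a Carathéodory solution of `y' = P y₁`, `y₁' = Q y - w` on `[c, d]`. -/
structure IsSystemSolution (P Q : ℝ → ℝ) (w y y₁ : ℝ → ℂ) (c d : ℝ) : Prop where
  ac : AbsolutelyContinuousOnInterval y c d
  ac₁ : AbsolutelyContinuousOnInterval y₁ c d
  hasDerivAt : ∀ᵐ x, x ∈ uIcc c d → HasDerivAt y (P x * y₁ x) x
  hasDerivAt₁ : ∀ᵐ x, x ∈ uIcc c d → HasDerivAt y₁ (Q x * y x - w x) x

namespace IsSystemSolution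

variable {P Q : ℝ → ℝ} {w y y₁ v z z₁ : ℝ → ℂ} {c d : ℝ}

/-- Lagrange's identity. -/
theorem integral_lagrange (hy : IsSystemSolution P Q w y y₁ c d)
    (hz : IsSystemSolution P Q v z z₁ c d) :
    ∫ x in c..d, (w x * z x - y x * v x) =
      (y d * z₁ d - y₁ d * z d) - (y c * z₁ c - y₁ c * z c) := by
  have hW : AbsolutelyContinuousOnInterval (fun x => y x * z₁ x - y₁ x * z x) c d :=
    (hy.ac.fun_smul hz.ac₁).fun_sub (hy.ac₁.fun_smul hz.ac)
  refine (hW.intervalIntegral_eq_sub ?_).2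
  filter_upwards [hy.hasDerivAt, hy.hasDerivAt₁, hz.hasDerivAt, hz.hasDerivAt₁]
    with x h1 h2 h3 h4 hx
  convert! ((h1 hx).mul (h4 hx)).sub ((h2 hx).mul (h3 hx)) using 1
  ring

theorem conj (hy : IsSystemSolution P Q w y y₁ c d) :
    IsSystemSolution P Q (fun x => starRingEnd ℂ (w x)) (fun x => starRingEnd ℂ (y x))
      (fun x => starRingEnd ℂ (y₁ x)) c d where
  ac := hy.ac.conj
  ac₁ := hy.ac₁.conj
  hasDerivAt := by
    filter_upwards [hy.hasDerivAt] with x h hx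
    simpa using (h hx).star
  hasDerivAt₁ := by
    filter_upwards [hy.hasDerivAt₁] with x h hx
    simpa using (h hx).star

/-- Used to propagate solutions of a system truncated to `[c, d]` as constants outside that
interval. -/
theorem eq_of_forall_eq_zero (hy : IsSystemSolution P Q w y y₁ c d)
    (hP : ∀ x ∈ uIoo c d, P x = 0) (hQ : ∀ x ∈ uIoo c d, Q x = 0)
    (hw : ∀ x ∈ uIoo c d, w x = 0) : y d = y c ∧ y₁ d = y₁ c := by
  constructor <;> rw [← sub_eq_zero]
  · rw [← (hy.ac.intervalIntegral_eq_sub hy.hasDerivAt).2,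
      intervalIntegral.integral_congr_uIoo (g := fun _ => 0) fun x hx => by simp [hP x hx]]
    simp
  · rw [← (hy.ac₁.intervalIntegral_eq_sub hy.hasDerivAt₁).2,
      intervalIntegral.integral_congr_uIoo (g := fun _ => 0)
        fun x hx => by simp [hQ x hx, hw x hx]]
    simp

end IsSystemSolution

theorem norm_intervalIntegral_le_integral_norm {f : ℝ → ℂ} (hf : Integrable f) (c x : ℝ) :
    ‖∫ t in c..x, f t‖ ≤ ∫ t, ‖f t‖ :=
  (intervalIntegral.norm_integral_le_integral_norm_uIoc).trans
    (setIntegral_le_integral hf.norm (Eventually.of_forall fun _ => norm_nonneg _))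

theorem integrable_ofReal_mul_of_bounded {P : ℝ → ℝ} (hP : Integrable P) {u : ℝ → ℂ}
    (hu : Continuous u) {M : ℝ} (hM : ∀ x, ‖u x‖ ≤ M) :
    Integrable (fun t => (P t : ℂ) * u t) :=
  hP.ofReal.mul_bdd (c := M) hu.aestronglyMeasurable (Eventually.of_forall hM)

theorem norm_intervalIntegral_mul_le {P : ℝ → ℝ} (hP : Integrable P)
    (hP' : ∫ t, ‖P t‖ ≤ 1 / 2) {u : ℝ → ℂ} (hu : Continuous u) {M : ℝ} (hM : ∀ x, ‖u x‖ ≤ M)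
    (c x : ℝ) : ‖∫ t in c..x, (P t : ℂ) * u t‖ ≤ 1 / 2 * M := by
  have hi := integrable_ofReal_mul_of_bounded hP hu hM
  refine (norm_intervalIntegral_le_integral_norm hi c x).trans ?_
  have hM0 : 0 ≤ M := (norm_nonneg _).trans (hM 0)
  calc ∫ t, ‖(P t : ℂ) * u t‖ ≤ ∫ t, ‖P t‖ * M := by
        refine integral_mono hi.norm (hP.norm.mul_const M) fun t => ?_
        simp only [norm_mul, Complex.norm_real]
        exact mul_le_mul_of_nonneg_left (hM t) (norm_nonneg _)
    _ ≤ 1 / 2 * M := by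
        rw [integral_mul_const]
        exact mul_le_mul_of_nonneg_right hP' hM0

open BoundedContinuousFunction in
-- Picard's integral operator acts on bounded continuous functions on the whole line. The smallness
-- of `∫ |P|` and `∫ |Q|` makes it a `1/2`-contraction in the sup norm, so one fixed point gives a
-- global solution.
theorem exists_isSystemSolution {P Q : ℝ → ℝ} {w : ℝ → ℂ} (hP : Integrable P) (hQ : Integrable Q)
    (hw : Integrable w) (hP' : ∫ t, ‖P t‖ ≤ 1 / 2) (hQ' : ∫ t, ‖Q t‖ ≤ 1 / 2) (e : ℝ) (α β : ℂ) :
    ∃ y y₁ : ℝ → ℂ, y e = α ∧ y₁ e = β ∧ ∀ c d, IsSystemSolution P Q w y y₁ c d := by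
  have i1 : ∀ u : ℝ →ᵇ ℂ × ℂ, Integrable (fun t => (P t : ℂ) * (u t).2) := fun u =>
    integrable_ofReal_mul_of_bounded hP (by fun_prop) (M := ‖u‖)
      fun x => (norm_snd_le _).trans (u.norm_coe_le_norm x)
  have i2 : ∀ u : ℝ →ᵇ ℂ × ℂ, Integrable (fun t => (Q t : ℂ) * (u t).1) := fun u =>
    integrable_ofReal_mul_of_bounded hQ (by fun_prop) (M := ‖u‖)
      fun x => (norm_fst_le _).trans (u.norm_coe_le_norm x)
  have i3 : ∀ u : ℝ →ᵇ ℂ × ℂ, Integrable (fun t => (Q t : ℂ) * (u t).1 - w t) :=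
    fun u => (i2 u).sub hw
  let F : (ℝ →ᵇ ℂ × ℂ) → ℝ → ℂ × ℂ := fun u x =>
    (α + ∫ t in e..x, (P t : ℂ) * (u t).2, β + ∫ t in e..x, ((Q t : ℂ) * (u t).1 - w t))
  have hFc : ∀ u, Continuous (F u) := fun u =>
    (continuous_const.add (intervalIntegral.continuous_primitive
      (fun _ _ => (i1 u).intervalIntegrable) e)).prodMk
    (continuous_const.add (intervalIntegral.continuous_primitive
      (fun _ _ => (i3 u).intervalIntegrable) e))
  have hFb : ∀ u x, ‖F u x‖ ≤ max (‖α‖ + ∫ t, ‖(P t : ℂ) * (u t).2‖)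
      (‖β‖ + ∫ t, ‖(Q t : ℂ) * (u t).1 - w t‖) := fun u x =>
    max_le_max ((norm_add_le _ _).trans
        (by gcongr; exact norm_intervalIntegral_le_integral_norm (i1 u) e x))
      ((norm_add_le _ _).trans
        (by gcongr; exact norm_intervalIntegral_le_integral_norm (i3 u) e x))
  let T : (ℝ →ᵇ ℂ × ℂ) → (ℝ →ᵇ ℂ × ℂ) := fun u => ofNormedAddCommGroup (F u) (hFc u) _ (hFb u)
  have hT : ContractingWith (1 / 2) T := by
    refine ⟨by norm_num, LipschitzWith.of_dist_le_mul fun u v => ?_⟩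
    rw [dist_le (by positivity)]
    intro x
    change max (dist (F u x).1 (F v x).1) (dist (F u x).2 (F v x).2) ≤ _
    have hd : ∀ t, ‖(u t).1 - (v t).1‖ ≤ dist u v ∧ ‖(u t).2 - (v t).2‖ ≤ dist u v := fun t => by
      have := u.dist_coe_le_dist (g := v) t
      rw [Prod.dist_eq, max_le_iff] at this
      exact ⟨by simpa only [dist_eq_norm (u t).1] using this.1,
        by simpa only [dist_eq_norm (u t).2] using this.2⟩
    refine max_le ?_ ?_
    · have := norm_intervalIntegral_mul_le hP hP' (u := fun t => (u t).2 - (v t).2)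
        (by fun_prop) (fun t => (hd t).2) e x
      rw [dist_eq_norm]
      simp only [F, add_sub_add_left_eq_sub]
      rw [← intervalIntegral.integral_sub (i1 u).intervalIntegrable (i1 v).intervalIntegrable]
      simpa [mul_sub] using this
    · have := norm_intervalIntegral_mul_le hQ hQ' (u := fun t => (u t).1 - (v t).1)
        (by fun_prop) (fun t => (hd t).1) e x
      rw [dist_eq_norm]
      simp only [F, add_sub_add_left_eq_sub]
      rw [← intervalIntegral.integral_sub (i3 u).intervalIntegrable (i3 v).intervalIntegrable]
      simpa [mul_sub] using this
  have hfix : T (hT.fixedPoint T) = hT.fixedPoint T := hT.fixedPoint_isFixedPt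
  generalize hT.fixedPoint T = u at hfix
  have e1 : ∀ x, (u x).1 = α + ∫ t in e..x, (P t : ℂ) * (u t).2 := fun x =>
    (congrArg Prod.fst (DFunLike.congr_fun hfix x)).symm
  have e2 : ∀ x, (u x).2 = β + ∫ t in e..x, ((Q t : ℂ) * (u t).1 - w t) := fun x =>
    (congrArg Prod.snd (DFunLike.congr_fun hfix x)).symm
  have hconst : ∀ (k : ℂ) c d, AbsolutelyContinuousOnInterval (fun _ : ℝ => k) c d :=
    fun k c d => (LipschitzWith.const k).lipschitzOnWith.absolutelyContinuousOnInterval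
  refine ⟨fun x => (u x).1, fun x => (u x).2, by simp [e1 e], by simp [e2 e],
    fun c d => ⟨?_, ?_, ?_, ?_⟩⟩
  · rw [funext e1]
    exact (hconst α c d).fun_add ((i1 u).absolutelyContinuousOnInterval_primitive e c d)
  · rw [funext e2]
    exact (hconst β c d).fun_add ((i3 u).absolutelyContinuousOnInterval_primitive e c d)
  · filter_upwards [LocallyIntegrable.ae_hasDerivAt_integral (i1 u).locallyIntegrable] with x hx _
    rw [funext e1]
    exact (hx e).const_add α
  · filter_upwards [LocallyIntegrable.ae_hasDerivAt_integral (i3 u).locallyIntegrable] with x hx _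
    rw [funext e2]
    exact (hx e).const_add β

section Operators

variable {a b : EReal} {p q r : ℝ → ℝ}

/-! ### The weighted space -/

/-- As `r > 0` a.e., `r dx` and `dx` have the same null sets in `(a, b)`. -/
theorem IsCoefficients.ae_weight_iff (h : IsCoefficients a b p q r) {S : ℝ → Prop} :
    (∀ᵐ x ∂(weight a b r), S x) ↔ ∀ᵐ x ∂(volume.restrict (openI a b)), S x :=
  ⟨fun hS => (withDensity_absolutelyContinuous' h.aemeasurable_r.ennreal_ofReal
      (h.r_pos.mono fun x hx => by simpa using hx)).ae_le hS,
    fun hS => (withDensity_absolutelyContinuous _ _).ae_le hS⟩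

theorem ae_mem_openI : ∀ᵐ x ∂(volume.restrict (openI a b)), x ∈ openI a b :=
  ae_restrict_mem (isOpen_openI a b).measurableSet

theorem ae_of_ae_openI {S : ℝ → Prop} (hS : ∀ᵐ x ∂(volume.restrict (openI a b)), S x)
    {J : Set ℝ} (hJ : J ⊆ openI a b) : ∀ᵐ x, x ∈ J → S x := by
  filter_upwards [(ae_restrict_iff' (isOpen_openI a b).measurableSet).1 hS] with x hx hm
    using hx (hJ hm)

theorem uIcc_subset_openI {c d : ℝ} (hc : c ∈ openI a b) (hd : d ∈ openI a b) :
    uIcc c d ⊆ openI a b :=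
  (ordConnected_openI a b).uIcc_subset hc hd

theorem exists_Ioo_superset (hab : a < b) {S : Set ℝ} (hS : IsCompact S) (hSI : S ⊆ openI a b) :
    ∃ c ∈ openI a b, ∃ d ∈ openI a b, c < d ∧ S ⊆ Ioo c d := by
  obtain ⟨x₀, h1, h2⟩ := EReal.lt_iff_exists_real_btwn.1 hab
  have hx₀ : x₀ ∈ openI a b := ⟨h1, h2⟩
  -- Inserting a point covers the case of empty `S`, where there would be no least or greatest
  -- element.
  have hS' : IsCompact (insert x₀ S) := hS.insert x₀
  have hSI' : insert x₀ S ⊆ openI a b := insert_subset hx₀ hSI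
  obtain ⟨m, hm, hm'⟩ := hS'.exists_isLeast (insert_nonempty _ _)
  obtain ⟨M, hM, hM'⟩ := hS'.exists_isGreatest (insert_nonempty _ _)
  obtain ⟨ε, hε, hb⟩ := Metric.isOpen_iff.1 (isOpen_openI a b) m (hSI' hm)
  obtain ⟨δ, hδ, hb'⟩ := Metric.isOpen_iff.1 (isOpen_openI a b) M (hSI' hM)
  refine ⟨m - ε / 2, hb ?_, M + δ / 2, hb' ?_, ?_, fun x hx => ⟨?_, ?_⟩⟩
  · rw [Real.ball_eq_Ioo]; constructor <;> linarith
  · rw [Real.ball_eq_Ioo]; constructor <;> linarith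
  · linarith [hm' hM]
  · linarith [hm' (mem_insert_of_mem x₀ hx)]
  · linarith [hM' (mem_insert_of_mem x₀ hx)]

theorem IsCoefficients.integral_weight (h : IsCoefficients a b p q r) (G : ℝ → ℂ) :
    ∫ x, G x ∂(weight a b r) = ∫ x in openI a b, (r x : ℂ) * G x := by
  rw [weight, integral_withDensity_eq_integral_toReal_smul₀ h.aemeasurable_r.ennreal_ofReal
    (Eventually.of_forall fun _ => ENNReal.ofReal_lt_top)]
  refine integral_congr_ae ?_
  filter_upwards [h.r_pos] with x hx
  rw [ENNReal.toReal_ofReal hx.le, Complex.real_smul]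

theorem IsCoefficients.integral_weight_eq_interval (h : IsCoefficients a b p q r) {G : ℝ → ℂ}
    {c d : ℝ} (hcd : c ≤ d) (hI : Icc c d ⊆ openI a b)
    (hG : ∀ᵐ x ∂(volume.restrict (openI a b)), x ∉ Icc c d → G x = 0) :
    ∫ x, G x ∂(weight a b r) = ∫ x in c..d, (r x : ℂ) * G x := by
  rw [h.integral_weight, intervalIntegral.integral_of_le hcd, ← integral_Icc_eq_integral_Ioc]
  refine setIntegral_eq_of_subset_of_ae_sdiff_eq_zero
    (isOpen_openI a b).measurableSet.nullMeasurableSet hI ?_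
  filter_upwards [(ae_restrict_iff' (isOpen_openI a b).measurableSet).1 hG] with x hx hm
  rw [hx hm.1 hm.2, mul_zero]

theorem inner_L2_eq_integral (f g : L2 a b r) :
    ⟪f, g⟫_ℂ = ∫ x, g x * starRingEnd ℂ (f x) ∂(weight a b r) := rfl

/-! ### The graphs of the operators -/

theorem mem_graph_Tmin0 (h : IsCoefficients a b p q r) (f g : L2 a b r) :
    (f, g) ∈ (Tmin0 a b p q r).graph ↔ TauRel a b p q r f g ∧ f ∈ compactlySupported a b r := by
  constructor
  · intro hfg
    refine ⟨(mem_graph_Tmax h f g).1 (LinearPMap.le_graph_of_le LinearPMap.domRestrict_le hfg), ?_⟩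
    exact (LinearPMap.mem_domain_of_mem_graph hfg).1
  · rintro ⟨hfg, hf⟩
    have hg := (mem_graph_Tmax h f g).2 hfg
    rw [LinearPMap.mem_graph_iff] at hg ⊢
    obtain ⟨y, hy, rfl⟩ := hg
    subst hy
    exact ⟨⟨y, hf, y.2⟩, rfl, LinearPMap.domRestrict_apply rfl⟩

theorem isSystemSolution_of_tau (h : IsCoefficients a b p q r) {y y₁ g : ℝ → ℂ}
    (hy : ACLoc (openI a b) y) (hy₁ : ACLoc (openI a b) y₁) (hq : IsQuasiDeriv a b p y y₁)
    (hg : g =ᵐ[weight a b r] fun x => (1 / r x) • (-deriv y₁ x + q x • y x)) {c d : ℝ}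
    (hc : c ∈ openI a b) (hd : d ∈ openI a b) :
    IsSystemSolution (fun x => 1 / p x) q (fun x => r x * g x) y y₁ c d where
  ac := hy c hc d hd
  ac₁ := hy₁ c hc d hd
  hasDerivAt := ae_of_ae_openI (by
    filter_upwards [hq, h.p_pos, hy.ae_differentiableAt] with x h1 h2 h3
    convert! h3.hasDerivAt using 1
    have : (p x : ℂ) ≠ 0 := by exact_mod_cast h2.ne'
    rw [h1, Complex.real_smul]
    push_cast
    field_simp) (uIcc_subset_openI hc hd)
  hasDerivAt₁ := ae_of_ae_openI (by
    filter_upwards [h.ae_weight_iff.1 hg, h.r_pos, hy₁.ae_differentiableAt] with x h1 h2 h3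
    convert! h3.hasDerivAt using 1
    have : (r x : ℂ) ≠ 0 := by exact_mod_cast h2.ne'
    rw [h1, Complex.real_smul, Complex.real_smul]
    push_cast
    field_simp
    ring) (uIcc_subset_openI hc hd)

/-- Integrate Lagrange's identity between two points of `(a, b)` on either side of the support of
`f`: the boundary terms vanish because `y` and `y₁` do. -/
theorem TauRel.inner_eq_of_compactlySupported (h : IsCoefficients a b p q r) {f f' g g' : L2 a b r}
    (hf : TauRel a b p q r f f') (hfc : f ∈ compactlySupported a b r)
    (hg : TauRel a b p q r g g') : ⟪f', g⟫_ℂ = ⟪f, g'⟫_ℂ := by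
  obtain ⟨y, y₁, hfy, hy, hy₁, hq, hf'⟩ := hf
  obtain ⟨z, z₁, hgz, hz, hz₁, hqz, hg'⟩ := hg
  obtain ⟨S, hS, hSI, hfS⟩ := hfc
  obtain ⟨c, hc, d, hd, hcd, hScd⟩ := exists_Ioo_superset h.lt hS hSI
  have hUo : IsOpen (openI a b \ S) := (isOpen_openI a b).sdiff hS.isClosed
  have hres : volume.restrict (openI a b \ S) ≤ volume.restrict (openI a b) :=
    Measure.restrict_mono sdiff_subset le_rfl
  have hmem := ae_restrict_mem (μ := volume) hUo.measurableSet
  -- The a.e. vanishing becomes pointwise by continuity on the open set `(a, b) \ S`, so `y` may be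
  -- evaluated at `c` and `d` and differentiated off `S`.
  have hy0 : EqOn y 0 (openI a b \ S) := by
    refine Measure.eqOn_open_of_ae_eq (μ := volume) ?_ hUo (hy.continuousOn.mono sdiff_subset)
      continuousOn_const
    filter_upwards [ae_mono hres (h.ae_weight_iff.1 hfy), ae_mono hres (h.ae_weight_iff.1 hfS),
      hmem] with x h1 h2 h3
    rw [← h1, h2 h3.2]; rfl
  have hder : ∀ w : ℝ → ℂ, EqOn w 0 (openI a b \ S) → ∀ x ∈ openI a b \ S, deriv w x = 0 := by
    intro w hw x hx
    have : w =ᶠ[𝓝 x] fun _ => (0 : ℂ) := hw.eventuallyEq_of_mem (hUo.mem_nhds hx)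
    rw [this.deriv_eq, deriv_const]
  have hy₁0 : EqOn y₁ 0 (openI a b \ S) := by
    refine Measure.eqOn_open_of_ae_eq (μ := volume) ?_ hUo (hy₁.continuousOn.mono sdiff_subset)
      continuousOn_const
    filter_upwards [ae_mono hres hq, hmem] with x h1 h2
    rw [h1, hder y hy0 x h2, smul_zero]; rfl
  have hcS : c ∈ openI a b \ S := ⟨hc, fun hh => (hScd hh).1.false⟩
  have hdS : d ∈ openI a b \ S := ⟨hd, fun hh => (hScd hh).2.false⟩
  have hII : Icc c d ⊆ openI a b := (ordConnected_openI a b).out hc hd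
  have hSc : ∀ {x}, x ∉ Icc c d → x ∉ S := fun hx hxS => hx (Ioo_subset_Icc_self (hScd hxS))
  have hL := (isSystemSolution_of_tau h hy hy₁ hq hf' hc hd).integral_lagrange
    (isSystemSolution_of_tau h hz hz₁ hqz hg' hc hd).conj
  rw [hy0 hcS, hy0 hdS, hy₁0 hcS, hy₁0 hdS] at hL
  -- The inner product is conjugate-linear in its first slot. After swapping the slots, `z` carries
  -- the conjugation, as in `hL`.
  rw [← inner_conj_symm f', ← inner_conj_symm f, ← sub_eq_zero, ← map_sub]
  suffices ⟪g, f'⟫_ℂ - ⟪g', f⟫_ℂ = 0 by rw [this, map_zero]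
  rw [inner_L2_eq_integral, inner_L2_eq_integral, ← integral_sub (L2.integrable_inner g f')
    (L2.integrable_inner g' f), h.integral_weight_eq_interval hcd.le hII]
  · refine Eq.trans (intervalIntegral.integral_congr_ae ?_) (hL.trans (by simp))
    filter_upwards [ae_of_ae_openI (h.ae_weight_iff.1 hfy) (uIcc_subset_openI hc hd),
      ae_of_ae_openI (h.ae_weight_iff.1 hgz) (uIcc_subset_openI hc hd)] with x h1 h2 hx
    rw [h1 (uIoc_subset_uIcc hx), h2 (uIoc_subset_uIcc hx), map_mul, Complex.conj_ofReal]
    ring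
  · filter_upwards [h.ae_weight_iff.1 hfS, h.ae_weight_iff.1 hf', ae_mem_openI] with x h1 h2 h3 h4
    have hxS : x ∈ openI a b \ S := ⟨h3, hSc h4⟩
    rw [h1 (hSc h4), h2, hder y₁ hy₁0 x hxS, hy0 hxS]
    simp

theorem Tmin0_le_Tmax : Tmin0 a b p q r ≤ Tmax a b p q r := LinearPMap.domRestrict_le

/-- By Lagrange's identity `T_max` is a formal adjoint of `T_min,0`, hence a restriction of the
closed operator `T_min,0*`. -/
theorem isClosable_Tmax (h : IsCoefficients a b p q r)
    (hd : Dense ((Tmin0 a b p q r).domain : Set (L2 a b r))) :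
    (Tmax a b p q r).IsClosable := by
  refine (LinearPMap.adjoint_isClosed hd).isClosable.leIsClosable
    (LinearPMap.IsFormalAdjoint.le_adjoint hd fun x y => ?_)
  obtain ⟨h1, h2⟩ := (mem_graph_Tmin0 h _ _).1 (LinearPMap.mem_graph _ x)
  exact h1.inner_eq_of_compactlySupported h h2 ((mem_graph_Tmax h _ _).1 (LinearPMap.mem_graph _ y))

/-! ### Density of the domain of the preminimal operator -/

theorem IsCoefficients.weight_Icc_lt_top (h : IsCoefficients a b p q r) {c d : ℝ}
    (hI : Icc c d ⊆ openI a b) : weight a b r (Icc c d) < ∞ := by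
  rw [weight, withDensity_apply _ measurableSet_Icc, Measure.restrict_restrict measurableSet_Icc,
    inter_eq_self_of_subset_left hI]
  exact (h.locInt_r.integrableOn_compact_subset hI isCompact_Icc).lintegral_lt_top

theorem IsCoefficients.memLp_indicator (h : IsCoefficients a b p q r) {c d : ℝ}
    (hI : Icc c d ⊆ openI a b) {u : ℝ → ℂ} (hu : ContinuousOn u (Icc c d)) :
    MemLp ((Icc c d).indicator u) 2 (weight a b r) := by
  rw [memLp_indicator_iff_restrict measurableSet_Icc]
  obtain ⟨M, hM⟩ := isCompact_Icc.exists_bound_of_continuousOn hu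
  have : IsFiniteMeasure ((weight a b r).restrict (Icc c d)) :=
    ⟨by rw [Measure.restrict_apply_univ]; exact h.weight_Icc_lt_top hI⟩
  exact MemLp.of_bound (hu.aestronglyMeasurable measurableSet_Icc) M
    ((ae_restrict_iff' measurableSet_Icc).2 (Eventually.of_forall hM))

/-- The measure `r dx` is finite on `[c, d]`, so `L²` lies in `L¹` there. This makes `r g`
admissible as an inhomogeneity. -/
theorem IsCoefficients.integrable_indicator_mul (h : IsCoefficients a b p q r) {c d : ℝ}
    (hI : Icc c d ⊆ openI a b) (g : L2 a b r) :
    Integrable ((Icc c d).indicator fun x => (r x : ℂ) * g x) := by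
  have : IsFiniteMeasure ((weight a b r).restrict (Icc c d)) :=
    ⟨by rw [Measure.restrict_apply_univ]; exact h.weight_Icc_lt_top hI⟩
  have h1 : Integrable g ((weight a b r).restrict (Icc c d)) :=
    ((Lp.memLp g).restrict (Icc c d)).integrable (by norm_num)
  have h2 : Integrable ((Icc c d).indicator g) (weight a b r) :=
    (integrable_indicator_iff measurableSet_Icc).2 h1
  have h2' := (integrable_withDensity_iff_integrable_smul₀' h.aemeasurable_r.ennreal_ofReal
    (Eventually.of_forall fun _ => ENNReal.ofReal_lt_top)).1 h2
  rw [integrable_indicator_iff measurableSet_Icc]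
  have h3 : IntegrableOn (fun x => (ENNReal.ofReal (r x)).toReal • (Icc c d).indicator g x)
      (Icc c d) := IntegrableOn.mono_set h2' hI
  refine h3.congr ?_
  filter_upwards [ae_restrict_mem measurableSet_Icc,
    ae_mono (Measure.restrict_mono hI le_rfl) h.r_pos] with x hx hr
  rw [indicator_of_mem hx, ENNReal.toReal_ofReal hr.le, Complex.real_smul]

theorem IsCoefficients.inner_indicator (h : IsCoefficients a b p q r) {c d : ℝ} (hcd : c ≤ d)
    (hI : Icc c d ⊆ openI a b) {f g : L2 a b r} {u : ℝ → ℂ}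
    (hf : f =ᵐ[weight a b r] (Icc c d).indicator u) :
    ⟪f, g⟫_ℂ = ∫ x in c..d, ((Icc c d).indicator (fun x => (r x : ℂ) * g x) x) *
      starRingEnd ℂ (u x) := by
  rw [inner_L2_eq_integral, h.integral_weight_eq_interval hcd hI]
  · refine intervalIntegral.integral_congr_ae ?_
    filter_upwards [ae_of_ae_openI (h.ae_weight_iff.1 hf) hI] with x hx hm
    rw [uIoc_of_le hcd] at hm
    have hm' := Ioc_subset_Icc_self hm
    rw [hx hm', indicator_of_mem hm', indicator_of_mem hm', mul_assoc]
  · filter_upwards [h.ae_weight_iff.1 hf] with x hx hm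
    rw [hx, indicator_of_notMem hm, map_zero, mul_zero]

/-- A solution of the truncated system that vanishes with its quasi-derivative at both ends of
`[c, d]` defines an element of the domain of the preminimal operator. -/
theorem exists_mem_graph_Tmin0 (h : IsCoefficients a b p q r) {c d : ℝ} (hcd : c < d)
    (hI : Icc c d ⊆ openI a b) {g : L2 a b r} {y y₁ : ℝ → ℂ}
    (hy : ∀ c' d', IsSystemSolution ((Icc c d).indicator fun x => 1 / p x) ((Icc c d).indicator q)
      ((Icc c d).indicator fun x => (r x : ℂ) * g x) y y₁ c' d')
    (hc : y c = 0) (hc₁ : y₁ c = 0) (hd : y d = 0) (hd₁ : y₁ d = 0) :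
    ∃ f : L2 a b r, f ∈ (Tmin0 a b p q r).domain ∧
      f =ᵐ[weight a b r] (Icc c d).indicator y := by
  -- Outside `[c, d]` the truncated system is trivial, so `y` and `y₁` keep the value zero they have
  -- at the ends.
  have hlt : ∀ x < c, y x = 0 ∧ y₁ x = 0 := fun x hx => by
    have hz : ∀ t ∈ uIoo c x, t ∉ Icc c d := fun t ht h' => by
      rw [uIoo_of_ge hx.le] at ht
      exact (ht.2.trans_le h'.1).false
    have := (hy c x).eq_of_forall_eq_zero (fun t ht => indicator_of_notMem (hz t ht) _)
      (fun t ht => indicator_of_notMem (hz t ht) _) (fun t ht => indicator_of_notMem (hz t ht) _)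
    rwa [hc, hc₁] at this
  have hgt : ∀ x > d, y x = 0 ∧ y₁ x = 0 := fun x hx => by
    have hz : ∀ t ∈ uIoo d x, t ∉ Icc c d := fun t ht h' => by
      rw [uIoo_of_le hx.le] at ht
      exact (ht.1.trans_le h'.2).false
    have := (hy d x).eq_of_forall_eq_zero (fun t ht => indicator_of_notMem (hz t ht) _)
      (fun t ht => indicator_of_notMem (hz t ht) _) (fun t ht => indicator_of_notMem (hz t ht) _)
    rwa [hd, hd₁] at this
  have hout : ∀ x ∉ Icc c d, y x = 0 ∧ y₁ x = 0 := fun x hx => by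
    rcases lt_or_ge x c with h1 | h1
    · exact hlt x h1
    · exact hgt x (not_le.1 fun h2 => hx ⟨h1, h2⟩)
  have hind : (Icc c d).indicator y = y :=
    indicator_eq_self.2 fun x hx => by_contra fun h' => hx (hout x h').1
  have hL := h.memLp_indicator hI ((hy c d).ac.continuousOn.mono (by rw [uIcc_of_le hcd.le]))
  have hf := hL.coeFn_toLp
  have hG : MemLp ((Icc c d).indicator g) 2 (weight a b r) :=
    (Lp.memLp g).indicator measurableSet_Icc
  have hder : ∀ w : ℝ → ℂ, (∀ x ∉ Icc c d, w x = 0) → ∀ x ∉ Icc c d, deriv w x = 0 := by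
    intro w hw x hx
    have : w =ᶠ[𝓝 x] fun _ => (0 : ℂ) :=
      eventually_of_mem (isClosed_Icc.isOpen_compl.mem_nhds hx) hw
    rw [this.deriv_eq, deriv_const]
  have hd1 : ∀ᵐ x ∂(volume.restrict (openI a b)),
      HasDerivAt y ((Icc c d).indicator (fun x => 1 / p x) x * y₁ x) x :=
    ae_restrict_openI_of_rat fun c' _ d' _ => (hy c' d').hasDerivAt
  have hd2 : ∀ᵐ x ∂(volume.restrict (openI a b)), HasDerivAt y₁
      ((Icc c d).indicator q x * y x - (Icc c d).indicator (fun x => (r x : ℂ) * g x) x) x :=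
    ae_restrict_openI_of_rat fun c' _ d' _ => (hy c' d').hasDerivAt₁
  refine ⟨hL.toLp _, LinearPMap.mem_domain_of_mem_graph (y := hG.toLp _)
    ((mem_graph_Tmin0 h _ _).2 ⟨⟨y, y₁, ?_, fun c' _ d' _ => (hy c' d').ac,
      fun c' _ d' _ => (hy c' d').ac₁, ?_, ?_⟩, ?_⟩), hf⟩
  · exact hf.trans (Eventually.of_forall fun x => congrFun hind x)
  · filter_upwards [hd1, h.p_pos] with x h1 h2
    by_cases hx : x ∈ Icc c d
    · have : (p x : ℂ) ≠ 0 := by exact_mod_cast h2.ne'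
      rw [h1.deriv, indicator_of_mem hx, Complex.real_smul]
      push_cast
      field_simp
    · rw [hder y (fun x hx => (hout x hx).1) x hx, (hout x hx).2, smul_zero]
  · filter_upwards [hG.coeFn_toLp, h.ae_weight_iff.2 hd2, h.ae_weight_iff.2 h.r_pos] with x h1 h2 h3
    rw [h1]
    by_cases hx : x ∈ Icc c d
    · have : (r x : ℂ) ≠ 0 := by exact_mod_cast h3.ne'
      rw [h2.deriv, indicator_of_mem hx, indicator_of_mem hx, indicator_of_mem hx,
        Complex.real_smul, Complex.real_smul]
      push_cast
      field_simp
      ring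
    · rw [hder y₁ (fun x hx => (hout x hx).2) x hx, (hout x hx).1, indicator_of_notMem hx]
      simp
  · refine ⟨Icc c d, isCompact_Icc, hI, ?_⟩
    filter_upwards [hf] with x h1 h2
    rw [h1, indicator_of_notMem h2]

theorem IsSystemSolution.combination {P Q : ℝ → ℝ} {w u u₁ v v₁ z z₁ : ℝ → ℂ} {c d : ℝ}
    (hu : IsSystemSolution P Q w u u₁ c d) (hv : IsSystemSolution P Q 0 v v₁ c d)
    (hz : IsSystemSolution P Q 0 z z₁ c d) (s t : ℂ) :
    IsSystemSolution P Q w (fun x => u x - (s * v x + t * z x))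
      (fun x => u₁ x - (s * v₁ x + t * z₁ x)) c d where
  ac := hu.ac.fun_sub ((hv.ac.const_smul s).fun_add (hz.ac.const_smul t))
  ac₁ := hu.ac₁.fun_sub ((hv.ac₁.const_smul s).fun_add (hz.ac₁.const_smul t))
  hasDerivAt := by
    filter_upwards [hu.hasDerivAt, hv.hasDerivAt, hz.hasDerivAt] with x h1 h2 h3 hx
    convert! (h1 hx).sub (((h2 hx).const_mul s).add ((h3 hx).const_mul t)) using 1
    ring
  hasDerivAt₁ := by
    filter_upwards [hu.hasDerivAt₁, hv.hasDerivAt₁, hz.hasDerivAt₁] with x h1 h2 h3 hx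
    convert! (h1 hx).sub (((h2 hx).const_mul s).add ((h3 hx).const_mul t)) using 1
    simp only [Pi.zero_apply]
    ring

/-- If the first component of a solution vanishes, so does the inhomogeneity. -/
theorem IsSystemSolution.inhomogeneity_eq_zero {P Q : ℝ → ℝ} {w y y₁ : ℝ → ℂ} {c d : ℝ}
    (hy : IsSystemSolution P Q w y y₁ c d) (hcd : c ≤ d) (hP : ∀ᵐ x, x ∈ Ioo c d → P x ≠ 0)
    (h0 : ∀ᵐ x, x ∈ Ioo c d → y x = 0) : ∀ᵐ x, x ∈ Ioo c d → w x = 0 := by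
  have hIu : Ioo c d ⊆ uIcc c d := by rw [uIcc_of_le hcd]; exact Ioo_subset_Icc_self
  have ext0 : ∀ v : ℝ → ℂ, ContinuousOn v (Ioo c d) → (∀ᵐ x, x ∈ Ioo c d → v x = 0) →
      EqOn v 0 (Ioo c d) := fun v hv hv0 =>
    Measure.eqOn_open_of_ae_eq (μ := volume) ((ae_restrict_iff' measurableSet_Ioo).2 hv0)
      isOpen_Ioo hv continuousOn_const
  have der0 : ∀ {v : ℝ → ℂ} {v' : ℂ} {x}, EqOn v 0 (Ioo c d) → x ∈ Ioo c d →
      HasDerivAt v v' x → v' = 0 := fun {v v' x} hv hx hd => by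
    have : v =ᶠ[𝓝 x] fun _ => (0 : ℂ) := hv.eventuallyEq_of_mem (isOpen_Ioo.mem_nhds hx)
    exact hd.unique ((hasDerivAt_const x (0 : ℂ)).congr_of_eventuallyEq this)
  have e1 := ext0 y (hy.ac.continuousOn.mono hIu) h0
  have e2 := ext0 y₁ (hy.ac₁.continuousOn.mono hIu) (by
    filter_upwards [hy.hasDerivAt, hP] with x h1 h2 hx
    have := der0 e1 hx (h1 (hIu hx))
    exact (mul_eq_zero.1 this).resolve_left (by exact_mod_cast h2 hx))
  filter_upwards [hy.hasDerivAt₁] with x h1 hx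
  have := der0 e2 hx (h1 (hIu hx))
  rw [e1 hx] at this
  simpa using this

/-- Let `u` solve `τ u = g`, and let `v`, `z` be a basis of solutions of `τ y = 0` on `[c, d]`. The
claim is that `u` is a combination of `v` and `z`, which forces `g = 0`. It is proved by testing `u`
against every `k` orthogonal to `v` and `z`: such a `k` equals `τ f` on `[c, d]` for some `f` in the
domain of `T_min,0`, and Lagrange's identity moves `τ` from `f` to `u`. -/
theorem eq_zero_on_Ioo_of_orthogonal (h : IsCoefficients a b p q r) {c d : ℝ} (hcd : c < d)
    (hI : Icc c d ⊆ openI a b)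
    (hP' : ∫ t, ‖(Icc c d).indicator (fun x => 1 / p x) t‖ ≤ 1 / 2)
    (hQ' : ∫ t, ‖(Icc c d).indicator q t‖ ≤ 1 / 2) {g : L2 a b r}
    (hg : ∀ f ∈ (Tmin0 a b p q r).domain, ⟪f, g⟫_ℂ = 0) :
    ∀ᵐ x, x ∈ Ioo c d → g x = 0 := by
  have hP : Integrable ((Icc c d).indicator fun x => 1 / p x) :=
    (integrable_indicator_iff measurableSet_Icc).2
      (h.locInt_inv_p.integrableOn_compact_subset hI isCompact_Icc)
  have hQ : Integrable ((Icc c d).indicator q) :=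
    (integrable_indicator_iff measurableSet_Icc).2
      (h.locInt_q.integrableOn_compact_subset hI isCompact_Icc)
  have hsolve := fun {w : ℝ → ℂ} (hw : Integrable w) =>
    exists_isSystemSolution hP hQ hw hP' hQ' c
  obtain ⟨u, u₁, -, -, hu⟩ := hsolve (h.integrable_indicator_mul hI g) 0 0
  obtain ⟨v, v₁, hvc, hv₁c, hv⟩ := hsolve (w := 0) (integrable_zero _ _ _) 1 0
  obtain ⟨z, z₁, hzc, hz₁c, hz⟩ := hsolve (w := 0) (integrable_zero _ _ _) 0 1
  have huIcc : Icc c d = uIcc c d := (uIcc_of_le hcd.le).symm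
  have hLu := h.memLp_indicator hI (huIcc ▸ (hu c d).ac.continuousOn)
  have hLv := h.memLp_indicator hI (huIcc ▸ (hv c d).ac.continuousOn)
  have hLz := h.memLp_indicator hI (huIcc ▸ (hz c d).ac.continuousOn)
  let U : L2 a b r := hLu.toLp _
  let V : L2 a b r := hLv.toLp _
  let Z : L2 a b r := hLz.toLp _
  -- The Wronskian of two homogeneous solutions is constant, and it is `1` at `c`.
  have hwr : v d * z₁ d - v₁ d * z d = 1 := by
    have := (hv c d).integral_lagrange (hz c d)
    simp [hvc, hv₁c, hzc, hz₁c] at this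
    linear_combination -this
  have hU : U ∈ (Submodule.span ℂ {V, Z})ᗮᗮ := by
    rw [Submodule.mem_orthogonal]
    intro k hk
    have hVk : ⟪V, k⟫_ℂ = 0 := hk V (Submodule.subset_span (by simp))
    have hZk : ⟪Z, k⟫_ℂ = 0 := hk Z (Submodule.subset_span (by simp))
    rw [h.inner_indicator hcd.le hI hLv.coeFn_toLp] at hVk
    rw [h.inner_indicator hcd.le hI hLz.coeFn_toLp] at hZk
    obtain ⟨f, f₁, hfc, hf₁c, hf⟩ := hsolve (h.integrable_indicator_mul hI k) 0 0
    have l1 := (hf c d).integral_lagrange (hv c d).conj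
    have l2 := (hf c d).integral_lagrange (hz c d).conj
    simp only [Pi.zero_apply, map_zero, mul_zero, sub_zero, hVk, hZk, hfc, hf₁c, zero_mul]
      at l1 l2
    have hwr' := congrArg (starRingEnd ℂ) hwr
    simp only [map_sub, map_mul, map_one] at hwr'
    -- Orthogonality of `k` to `v` and `z` says that `(f d, f₁ d)` has zero Wronskian with both
    -- conjugated basis solutions. Their own Wronskian is `1`, so Cramer's rule gives zero.
    have hfd : f d = 0 := by
      linear_combination (-f d) * hwr' - (starRingEnd ℂ (v d)) * l2 + (starRingEnd ℂ (z d)) * l1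
    have hf₁d : f₁ d = 0 := by
      linear_combination (-f₁ d) * hwr' - (starRingEnd ℂ (v₁ d)) * l2
        + (starRingEnd ℂ (z₁ d)) * l1
    obtain ⟨F, hF, hFf⟩ := exists_mem_graph_Tmin0 h hcd hI hf hfc hf₁c hfd hf₁d
    have hFg := hg F hF
    rw [h.inner_indicator hcd.le hI hFf] at hFg
    have l3 := (hf c d).integral_lagrange (hu c d).conj
    simp only [hfd, hf₁d, hfc, hf₁c, zero_mul, sub_zero] at l3
    have ac1 : IntervalIntegrable (fun x => (Icc c d).indicator (fun x => (r x : ℂ) * k x) x *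
        starRingEnd ℂ (u x)) volume c d :=
      (h.integrable_indicator_mul hI k).intervalIntegrable.mul_continuousOn
        (hu c d).ac.conj.continuousOn
    have ac2 : IntervalIntegrable (fun x => f x * starRingEnd ℂ
        ((Icc c d).indicator (fun x => (r x : ℂ) * g x) x)) volume c d := by
      have := ((Complex.conjCLE : ℂ →L[ℝ] ℂ).integrable_comp
        (h.integrable_indicator_mul hI g)).intervalIntegrable.continuousOn_mul
        (hf c d).ac.continuousOn
      exact this
    have hconj : ∫ x in c..d, f x * starRingEnd ℂ
        ((Icc c d).indicator (fun x => (r x : ℂ) * g x) x) = 0 := by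
      rw [← map_zero (starRingEnd ℂ), ← hFg, ← intervalIntegral.intervalIntegral_conj]
      simp only [map_mul, RCLike.conj_conj, mul_comm]
    rw [intervalIntegral.integral_sub ac1 ac2, hconj, sub_zero] at l3
    rw [← inner_conj_symm, h.inner_indicator hcd.le hI hLu.coeFn_toLp, l3, map_zero]
  have : FiniteDimensional ℂ (Submodule.span ℂ {V, Z}) :=
    FiniteDimensional.span_of_finite ℂ (by simp)
  have : CompleteSpace (Submodule.span ℂ {V, Z}) := FiniteDimensional.complete ℂ _
  -- A finite-dimensional subspace is complete, so it equals its double orthogonal complement.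
  rw [Submodule.orthogonal_orthogonal, Submodule.mem_span_pair] at hU
  obtain ⟨s, t, hst⟩ := hU
  have hcomb := (hu c d).combination (hv c d) (hz c d) s t
  have hw0 := hcomb.inhomogeneity_eq_zero hcd.le ?_ ?_
  · filter_upwards [hw0, ae_of_ae_openI h.r_pos hI] with x h1 h2 hx
    have hx' := Ioo_subset_Icc_self hx
    have h3 := h1 hx
    rw [indicator_of_mem hx'] at h3
    exact (mul_eq_zero.1 h3).resolve_left (by exact_mod_cast (h2 hx').ne')
  · filter_upwards [ae_of_ae_openI h.p_pos hI] with x h1 hx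
    have hx' := Ioo_subset_Icc_self hx
    rw [indicator_of_mem hx']
    exact (one_div_pos.2 (h1 hx')).ne'
  · have hae : ∀ᵐ x ∂(weight a b r), s * (Icc c d).indicator v x + t * (Icc c d).indicator z x =
        (Icc c d).indicator u x := by
      filter_upwards [hLu.coeFn_toLp, hLv.coeFn_toLp, hLz.coeFn_toLp, Lp.coeFn_add (s • V) (t • Z),
        Lp.coeFn_smul s V, Lp.coeFn_smul t Z] with x h1 h2 h3 h4 h5 h6
      rw [← h1, ← h2, ← h3]
      change _ = U x
      rw [← hst, h4, Pi.add_apply, h5, h6]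
      rfl
    filter_upwards [ae_of_ae_openI (h.ae_weight_iff.1 hae) hI] with x h1 hx
    have hx' := Ioo_subset_Icc_self hx
    have h2 := h1 hx'
    rw [indicator_of_mem hx', indicator_of_mem hx', indicator_of_mem hx'] at h2
    rw [h2, sub_self]

/-- The integrals of `1 / p` and `|q|` over `[x₀ - δ, x₀ + δ]` depend continuously on `δ` and vanish
at `δ = 0`. The bound `1/2` is what the contraction argument needs. -/
theorem exists_small_Icc (h : IsCoefficients a b p q r) {x₀ : ℝ} (hx₀ : x₀ ∈ openI a b) :
    ∃ c d, c < x₀ ∧ x₀ < d ∧ Icc c d ⊆ openI a b ∧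
      ∫ t, ‖(Icc c d).indicator (fun x => 1 / p x) t‖ ≤ 1 / 2 ∧
      ∫ t, ‖(Icc c d).indicator q t‖ ≤ 1 / 2 := by
  obtain ⟨ε, hε, hb⟩ := Metric.nhds_basis_closedBall.mem_iff.1 ((isOpen_openI a b).mem_nhds hx₀)
  rw [Real.closedBall_eq_Icc] at hb
  have key : ∀ f : ℝ → ℝ, LocallyIntegrableOn f (openI a b) →
      ∀ᶠ δ in 𝓝[>] (0 : ℝ), ∫ t, ‖(Icc (x₀ - δ) (x₀ + δ)).indicator f t‖ ≤ 1 / 2 := by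
    intro f hf
    have hfi : Integrable ((Icc (x₀ - ε) (x₀ + ε)).indicator fun t => ‖f t‖) :=
      (integrable_indicator_iff measurableSet_Icc).2
        (hf.integrableOn_compact_subset hb isCompact_Icc).norm
    have hc : Continuous fun δ : ℝ => ∫ t in (x₀ - δ)..(x₀ + δ),
        (Icc (x₀ - ε) (x₀ + ε)).indicator (fun t => ‖f t‖) t := by
      have hF := intervalIntegral.continuous_primitive
        (fun c d => hfi.intervalIntegrable (a := c) (b := d)) x₀
      have : (fun δ : ℝ => ∫ t in (x₀ - δ)..(x₀ + δ),
          (Icc (x₀ - ε) (x₀ + ε)).indicator (fun t => ‖f t‖) t) = fun δ =>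
          (∫ t in x₀..(x₀ + δ), (Icc (x₀ - ε) (x₀ + ε)).indicator (fun t => ‖f t‖) t) -
          ∫ t in x₀..(x₀ - δ), (Icc (x₀ - ε) (x₀ + ε)).indicator (fun t => ‖f t‖) t := by
        funext δ
        rw [intervalIntegral.integral_interval_sub_left hfi.intervalIntegrable
          hfi.intervalIntegrable]
      rw [this]
      exact (hF.comp (by fun_prop)).sub (hF.comp (by fun_prop))
    have h0 := (hc.tendsto 0).mono_left (nhdsWithin_le_nhds (s := Ioi 0))
    simp only [sub_zero, add_zero, intervalIntegral.integral_same] at h0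
    filter_upwards [h0.eventually (gt_mem_nhds (show (0 : ℝ) < 1 / 2 by norm_num)),
      Ioo_mem_nhdsGT hε] with δ h1 h2
    refine le_trans (le_of_eq ?_) h1.le
    rw [intervalIntegral.integral_of_le (by linarith [h2.1]), ← integral_Icc_eq_integral_Ioc,
      ← integral_indicator measurableSet_Icc]
    refine integral_congr_ae (Eventually.of_forall fun t => ?_)
    by_cases ht : t ∈ Icc (x₀ - δ) (x₀ + δ)
    · have ht' : t ∈ Icc (x₀ - ε) (x₀ + ε) := ⟨by linarith [ht.1, h2.2], by linarith [ht.2, h2.2]⟩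
      simp only [indicator_of_mem ht, indicator_of_mem ht']
    · simp only [indicator_of_notMem ht, norm_zero]
  obtain ⟨δ, h1, h2, h3⟩ := ((key _ h.locInt_inv_p).and
    ((key _ h.locInt_q).and (Ioo_mem_nhdsGT hε))).exists
  exact ⟨x₀ - δ, x₀ + δ, by linarith [h3.1], by linarith [h3.1],
    (Icc_subset_Icc (by linarith [h3.2]) (by linarith [h3.2])).trans hb, h1, h2⟩

theorem dense_domain_Tmin0 (h : IsCoefficients a b p q r) :
    Dense ((Tmin0 a b p q r).domain : Set (L2 a b r)) := by
  rw [Submodule.dense_iff_topologicalClosure_eq_top, Submodule.topologicalClosure_eq_top_iff,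
    Submodule.eq_bot_iff]
  intro g hg
  refine Lp.ext ?_
  have : ∀ᵐ x ∂(volume.restrict (openI a b)), g x = 0 := by
    rw [ae_restrict_iff' (isOpen_openI a b).measurableSet, ae_iff]
    -- A set that is null near each of its points is null, so vanishing on short intervals suffices.
    refine measure_null_of_locally_null _ fun x hx => ?_
    have hxI : x ∈ openI a b := by
      by_contra h'
      exact hx fun h'' => absurd h'' h'
    obtain ⟨c, d, hc, hd, hI, hP, hQ⟩ := exists_small_Icc h hxI
    have h0 := eq_zero_on_Ioo_of_orthogonal h (hc.trans hd) hI hP hQ hg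
    refine ⟨{y | ¬(y ∈ openI a b → g y = 0)} ∩ Ioo c d,
      inter_mem_nhdsWithin _ (Ioo_mem_nhds hc hd), ?_⟩
    rw [ae_iff] at h0
    refine measure_mono_null (fun y hy => ?_) h0
    exact fun h' => hy.1 fun _ => h' hy.2
  filter_upwards [h.ae_weight_iff.2 this, Lp.coeFn_zero ℂ 2 (weight a b r)] with x h1 h2
  rw [h1, h2]
  rfl

end Operators

/-! ### Invariance from maps of the graph -/

section Abstract

variable {H : Type*} [NormedAddCommGroup H] [InnerProductSpace ℂ H]

theorem mem_graph_conjOp [CompleteSpace H] {K : H →L[ℂ] H} {T : H →ₗ.[ℂ] H} {f g : H} :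
    (f, g) ∈ (conjOp K T).graph ↔
      ∃ h, (K f, h) ∈ T.graph ∧ ContinuousLinearMap.adjoint K h = g := by
  constructor
  · intro hfg
    obtain ⟨x, rfl, rfl⟩ := (LinearPMap.mem_graph_iff _).1 hfg
    exact ⟨T ⟨K x, x.2⟩, LinearPMap.mem_graph T ⟨K x, x.2⟩, rfl⟩
  · rintro ⟨h, hh, rfl⟩
    obtain ⟨⟨x, hx⟩, hxK, rfl⟩ := (LinearPMap.mem_graph_iff _).1 hh
    simp only at hxK
    subst hxK
    exact (LinearPMap.mem_graph_iff _).2 ⟨⟨f, hx⟩, rfl, rfl⟩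

/-- `h1` and `hJ` give `T ⊆ K* T K`. Conversely, if `(K f, h)` is in the graph, `h2` returns `(f, J'
h)` and `h1` then yields `(K f, J (J' h))`. Single-valuedness of `T` forces `h = J (J' h)`, hence
`K* h = J' h`; no relation between `J` and `J'` is needed beforehand. -/
theorem conjOp_eq_of_graph_maps [CompleteSpace H] {K K' J J' : H →L[ℂ] H} {T : H →ₗ.[ℂ] H}
    (hK : ∀ f, K' (K f) = f) (hJ : ∀ g, ContinuousLinearMap.adjoint K (J g) = g)
    (h1 : ∀ f g, (f, g) ∈ T.graph → (K f, J g) ∈ T.graph)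
    (h2 : ∀ f g, (f, g) ∈ T.graph → (K' f, J' g) ∈ T.graph) : conjOp K T = T := by
  refine LinearPMap.eq_of_eq_graph (Submodule.ext ?_)
  rintro ⟨f, g⟩
  rw [mem_graph_conjOp]
  constructor
  · rintro ⟨h, hh, rfl⟩
    have h3 := h2 _ _ hh
    rw [hK] at h3
    have h4 : h = J (J' h) := T.mem_graph_snd_inj hh (h1 _ _ h3) rfl
    have h5 := hJ (J' h)
    rw [← h4] at h5
    rwa [h5]
  · exact fun hfg => ⟨J g, h1 _ _ hfg, hJ g⟩

theorem graph_closure_maps {K J : H →L[ℂ] H} {T : H →ₗ.[ℂ] H} (hT : T.IsClosable)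
    (h : ∀ f g, (f, g) ∈ T.graph → (K f, J g) ∈ T.graph) (f g : H)
    (hfg : (f, g) ∈ T.closure.graph) : (K f, J g) ∈ T.closure.graph := by
  rw [← hT.graph_closure_eq_closure_graph] at hfg ⊢
  have hmaps : MapsTo (K.prodMap J) (T.graph : Set (H × H)) T.graph :=
    fun z hz => h z.1 z.2 hz
  exact hmaps.closure (K.prodMap J).continuous hfg

end Abstract

/-! ### Increasing diffeomorphisms of the interval -/

/-- `φ` is an increasing `C¹`-diffeomorphism of `(a, b)` with derivative `φ'` and inverse `ψ`. -/
structure IsDiffeo (a b : EReal) (φ φ' ψ : ℝ → ℝ) : Prop where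
  mapsTo : MapsTo φ (openI a b) (openI a b)
  mapsTo_inv : MapsTo ψ (openI a b) (openI a b)
  left_inv : ∀ x ∈ openI a b, ψ (φ x) = x
  right_inv : ∀ x ∈ openI a b, φ (ψ x) = x
  hasDerivAt : ∀ x ∈ openI a b, HasDerivAt φ (φ' x) x
  deriv_pos : ∀ x ∈ openI a b, 0 < φ' x
  continuousOn_deriv : ContinuousOn φ' (openI a b)

namespace IsDiffeo

variable {a b : EReal} {φ φ' ψ : ℝ → ℝ}

theorem continuousOn (D : IsDiffeo a b φ φ' ψ) : ContinuousOn φ (openI a b) :=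
  fun x hx => (D.hasDerivAt x hx).continuousAt.continuousWithinAt

theorem strictMonoOn (D : IsDiffeo a b φ φ' ψ) : StrictMonoOn φ (openI a b) := by
  refine strictMonoOn_of_deriv_pos (ordConnected_openI a b).convex D.continuousOn fun x hx => ?_
  rw [(isOpen_openI a b).interior_eq] at hx
  rw [(D.hasDerivAt x hx).deriv]
  exact D.deriv_pos x hx

theorem image_eq (D : IsDiffeo a b φ φ' ψ) : φ '' openI a b = openI a b :=
  Subset.antisymm D.mapsTo.image_subset fun x hx => ⟨ψ x, D.mapsTo_inv hx, D.right_inv x hx⟩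

theorem symm (D : IsDiffeo a b φ φ' ψ) : IsDiffeo a b ψ (fun x => (φ' (ψ x))⁻¹) φ := by
  have hmono : MonotoneOn ψ (openI a b) := fun x hx y hy hxy => by
    by_contra! hlt
    have := D.strictMonoOn (D.mapsTo_inv hy) (D.mapsTo_inv hx) hlt
    rw [D.right_inv x hx, D.right_inv y hy] at this
    exact (this.trans_le hxy).false
  have himg : ψ '' openI a b = openI a b :=
    Subset.antisymm D.mapsTo_inv.image_subset fun x hx => ⟨φ x, D.mapsTo hx, D.left_inv x hx⟩
  -- A monotone map whose image is a neighbourhood of the value has no jump.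
  have hcont : ∀ x ∈ openI a b, ContinuousAt ψ x := fun x hx =>
    continuousAt_of_monotoneOn_of_image_mem_nhds hmono ((isOpen_openI a b).mem_nhds hx)
      (himg.symm ▸ (isOpen_openI a b).mem_nhds (D.mapsTo_inv hx))
  refine ⟨D.mapsTo_inv, D.mapsTo, D.right_inv, D.left_inv, fun x hx => ?_, fun x hx => ?_, ?_⟩
  · exact HasDerivAt.of_local_left_inverse (hcont x hx) (D.hasDerivAt _ (D.mapsTo_inv hx))
      (D.deriv_pos _ (D.mapsTo_inv hx)).ne'
      (eventually_of_mem ((isOpen_openI a b).mem_nhds hx) D.right_inv)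
  · exact inv_pos.2 (D.deriv_pos _ (D.mapsTo_inv hx))
  · exact (D.continuousOn_deriv.comp (fun x hx => (hcont x hx).continuousWithinAt)
      D.mapsTo_inv).inv₀ fun x hx => (D.deriv_pos _ (D.mapsTo_inv hx)).ne'

/-- The exceptional set of `S ∘ φ` is contained in the `ψ`-image of that of `S`, and the
differentiable map `ψ` preserves null sets. -/
theorem ae_comp (D : IsDiffeo a b φ φ' ψ) {S : ℝ → Prop}
    (hS : ∀ᵐ x ∂(volume.restrict (openI a b)), S x) :
    ∀ᵐ x ∂(volume.restrict (openI a b)), S (φ x) := by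
  rw [ae_restrict_iff' (isOpen_openI a b).measurableSet, ae_iff] at hS ⊢
  have hd : DifferentiableOn ℝ ψ {x | ¬(x ∈ openI a b → S x)} := fun x hx =>
    (D.symm.hasDerivAt x (Classical.not_imp.1 hx).1).differentiableAt.differentiableWithinAt
  refine measure_mono_null (fun x hx => ?_)
    (addHaar_image_eq_zero_of_differentiableOn_of_addHaar_eq_zero volume hd hS)
  obtain ⟨h1, h2⟩ := Classical.not_imp.1 hx
  exact ⟨φ x, fun h => h2 (h (D.mapsTo h1)), D.left_inv x h1⟩

theorem acLoc_comp (D : IsDiffeo a b φ φ' ψ) {E : Type*} [NormedAddCommGroup E] {y : ℝ → E}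
    (hy : ACLoc (openI a b) y) : ACLoc (openI a b) (fun x => y (φ x)) := by
  intro c hc d hd
  have hsub := uIcc_subset_openI hc hd
  refine (hy _ (D.mapsTo hc) _ (D.mapsTo hd)).comp_monotoneOn
    (D.strictMonoOn.monotoneOn.mono hsub) ?_
  obtain ⟨M, hM⟩ := isCompact_uIcc.exists_bound_of_continuousOn (D.continuousOn_deriv.mono hsub)
  have hM0 : 0 ≤ M := (norm_nonneg _).trans (hM c left_mem_uIcc)
  exact ((convex_uIcc c d).lipschitzOnWith_of_nnnorm_hasDerivWithin_le (C := ⟨M, hM0⟩)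
    (fun x hx => (D.hasDerivAt x (hsub hx)).hasDerivWithinAt)
    (fun x hx => hM x hx)).absolutelyContinuousOnInterval

theorem setLIntegral_comp (D : IsDiffeo a b φ φ' ψ) (G : ℝ → ℝ≥0∞) :
    ∫⁻ x in openI a b, ENNReal.ofReal (φ' x) * G (φ x) = ∫⁻ x in openI a b, G x := by
  conv_rhs => rw [← D.image_eq]
  rw [lintegral_image_eq_lintegral_abs_deriv_mul (isOpen_openI a b).measurableSet
    (fun x hx => (D.hasDerivAt x hx).hasDerivWithinAt) D.strictMonoOn.injOn]
  refine setLIntegral_congr_fun (isOpen_openI a b).measurableSet fun x hx => ?_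
  rw [abs_of_pos (D.deriv_pos x hx)]

theorem setIntegral_comp (D : IsDiffeo a b φ φ' ψ) (G : ℝ → ℂ) :
    ∫ x in openI a b, (φ' x : ℂ) * G (φ x) = ∫ x in openI a b, G x := by
  conv_rhs => rw [← D.image_eq]
  rw [integral_image_eq_integral_abs_deriv_smul (isOpen_openI a b).measurableSet
    (fun x hx => (D.hasDerivAt x hx).hasDerivWithinAt) D.strictMonoOn.injOn]
  refine setIntegral_congr_fun (isOpen_openI a b).measurableSet fun x hx => ?_
  rw [abs_of_pos (D.deriv_pos x hx), Complex.real_smul]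

end IsDiffeo

/-! ### Weighted composition operators -/

section WeightedComposition

variable {a b : EReal} {p q r φ φ' ψ A B : ℝ → ℝ} {C : ℝ}

theorem IsCoefficients.ae_comp (h : IsCoefficients a b p q r) (D : IsDiffeo a b φ φ' ψ)
    {S : ℝ → Prop} (hS : ∀ᵐ x ∂(weight a b r), S x) : ∀ᵐ x ∂(weight a b r), S (φ x) :=
  h.ae_weight_iff.2 (D.ae_comp (h.ae_weight_iff.1 hS))

theorem IsDiffeo.aestronglyMeasurable_smul_comp
    (D : IsDiffeo a b φ φ' ψ) (hB : ContinuousOn B (openI a b)) (f : L2 a b r) :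
    AEStronglyMeasurable (fun x => B x • f (φ x)) (volume.restrict (openI a b)) := by
  refine (hB.aestronglyMeasurable (isOpen_openI a b).measurableSet).smul ?_
  exact (Lp.stronglyMeasurable f).aestronglyMeasurable.comp_aemeasurable
    (D.continuousOn.aemeasurable (isOpen_openI a b).measurableSet)

theorem IsCoefficients.lintegral_weight (h : IsCoefficients a b p q r) {G : ℝ → ℝ≥0∞}
    (hG : AEMeasurable G (volume.restrict (openI a b))) :
    ∫⁻ x, G x ∂(weight a b r) = ∫⁻ x in openI a b, ENNReal.ofReal (r x) * G x :=
  lintegral_withDensity_eq_lintegral_mul₀ h.aemeasurable_r.ennreal_ofReal hG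

/-- Since `r = (r ∘ φ) / C`, the integrand `r B² |f ∘ φ|²` is `(B² / φ') / C` times `φ' ((r |f|²) ∘
φ)`. The first factor is at most `M / C`, and the second integrates to `‖f‖²` by substitution. -/
theorem IsCoefficients.eLpNorm_comp_le (h : IsCoefficients a b p q r) (D : IsDiffeo a b φ φ' ψ)
    (hB : ContinuousOn B (openI a b)) {M : ℝ} (hM0 : 0 ≤ M)
    (hM : ∀ x ∈ openI a b, B x ^ 2 / φ' x ≤ M)
    (hC : 0 < C) (hr : ∀ᵐ x ∂(volume.restrict (openI a b)), r (φ x) = C * r x) (f : L2 a b r) :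
    eLpNorm (fun x => B x • f (φ x)) 2 (weight a b r) ≤
      ENNReal.ofReal ((M / C) ^ (1 / 2 : ℝ)) * eLpNorm f 2 (weight a b r) := by
  rw [eLpNorm_eq_lintegral_rpow_enorm_toReal (by norm_num) (by norm_num),
    eLpNorm_eq_lintegral_rpow_enorm_toReal (by norm_num) (by norm_num),
    ← ENNReal.ofReal_rpow_of_nonneg (by positivity) (by norm_num)]
  simp only [ENNReal.toReal_ofNat]
  rw [← ENNReal.mul_rpow_of_nonneg _ _ (by norm_num)]
  refine ENNReal.rpow_le_rpow ?_ (by norm_num)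
  rw [h.lintegral_weight ((D.aestronglyMeasurable_smul_comp hB f).enorm.pow_const _),
    h.lintegral_weight ((Lp.stronglyMeasurable f).measurable.enorm.pow_const _).aemeasurable,
    ← D.setLIntegral_comp (fun x => ENNReal.ofReal (r x) * ‖f x‖ₑ ^ (2 : ℝ)), ← lintegral_const_mul' _ _ ENNReal.ofReal_ne_top]
  refine lintegral_mono_ae ?_
  filter_upwards [hr, h.r_pos, ae_mem_openI] with x h1 h2 h3
  have hφ := D.deriv_pos x h3
  rw [h1, enorm_smul, ENNReal.mul_rpow_of_nonneg _ _ (by norm_num), Real.enorm_eq_ofReal_abs,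
    ENNReal.ofReal_rpow_of_nonneg (abs_nonneg _) (by norm_num), Real.rpow_two, sq_abs,
    ← mul_assoc, ← mul_assoc, ← mul_assoc, ← ENNReal.ofReal_mul h2.le,
    ← ENNReal.ofReal_mul (by positivity), ← ENNReal.ofReal_mul (by positivity)]
  gcongr ENNReal.ofReal ?_ * _
  have h4 := (div_le_iff₀ hφ).1 (hM x h3)
  calc r x * B x ^ 2 ≤ r x * (M * φ' x) := by gcongr
    _ = M / C * φ' x * (C * r x) := by field_simp

theorem IsCoefficients.exists_isWeightedComposition (h : IsCoefficients a b p q r)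
    (D : IsDiffeo a b φ φ' ψ) (hB : ContinuousOn B (openI a b))
    (hM : BddAbove ((fun x => B x ^ 2 / φ' x) '' openI a b))
    (hC : 0 < C) (hr : ∀ᵐ x ∂(volume.restrict (openI a b)), r (φ x) = C * r x) :
    ∃ K : L2 a b r →L[ℂ] L2 a b r, IsWeightedComposition B φ K := by
  obtain ⟨M, hM⟩ := hM
  have hbd := h.eLpNorm_comp_le D hB (le_max_right M 0)
    (fun x hx => (hM (mem_image_of_mem _ hx)).trans (le_max_left M 0)) hC hr
  have hLp : ∀ f : L2 a b r, MemLp (fun x => B x • f (φ x)) 2 (weight a b r) := fun f =>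
    ⟨(D.aestronglyMeasurable_smul_comp hB f).mono_ac (withDensity_absolutelyContinuous _ _),
      (hbd f).trans_lt (ENNReal.mul_lt_top ENNReal.ofReal_lt_top (Lp.eLpNorm_lt_top f))⟩
  let K₀ : L2 a b r →ₗ[ℂ] L2 a b r :=
    { toFun := fun f => (hLp f).toLp _
      map_add' := fun f g => by
        refine Lp.ext ?_
        filter_upwards [(hLp (f + g)).coeFn_toLp, (hLp f).coeFn_toLp, (hLp g).coeFn_toLp,
          Lp.coeFn_add ((hLp f).toLp _) ((hLp g).toLp _), h.ae_comp D (Lp.coeFn_add f g)]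
          with x h1 h2 h3 h4 h5
        rw [h1, h4, Pi.add_apply, h2, h3, h5, Pi.add_apply, smul_add]
      map_smul' := fun k f => by
        refine Lp.ext ?_
        filter_upwards [(hLp (k • f)).coeFn_toLp, (hLp f).coeFn_toLp,
          Lp.coeFn_smul k ((hLp f).toLp _), h.ae_comp D (Lp.coeFn_smul k f)]
          with x h1 h2 h3 h4
        rw [h1, RingHom.id_apply, h3, Pi.smul_apply, h2, h4, Pi.smul_apply, smul_comm] }
  refine ⟨K₀.mkContinuous ((max M 0 / C) ^ (1 / 2 : ℝ)) fun f => ?_, fun f => (hLp f).coeFn_toLp⟩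
  change ‖(hLp f).toLp _‖ ≤ _
  rw [Lp.norm_toLp, Lp.norm_def]
  refine (ENNReal.toReal_mono (ENNReal.mul_lt_top ENNReal.ofReal_lt_top
    (Lp.eLpNorm_lt_top f)).ne (hbd f)).trans_eq ?_
  rw [ENNReal.toReal_mul, ENNReal.toReal_ofReal (by positivity)]

theorem IsWeightedComposition.unique {K K' : L2 a b r →L[ℂ] L2 a b r}
    (hK : IsWeightedComposition A φ K) (hK' : IsWeightedComposition A φ K') : K = K' :=
  ContinuousLinearMap.ext fun f => Lp.ext ((hK f).trans (hK' f).symm)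

theorem IsWeightedComposition.comp_eq_self (h : IsCoefficients a b p q r)
    (D : IsDiffeo a b φ φ' ψ) {K K' : L2 a b r →L[ℂ] L2 a b r}
    (hK : IsWeightedComposition A φ K) (hK' : IsWeightedComposition B ψ K')
    (hAB : ∀ x ∈ openI a b, A x * B (φ x) = 1) (f : L2 a b r) : K (K' f) = f := by
  refine Lp.ext ?_
  filter_upwards [hK (K' f), h.ae_comp D (hK' f), h.ae_weight_iff.2 ae_mem_openI] with x h1 h2 h3
  rw [h1, h2, D.left_inv x h3, smul_smul, hAB x h3, one_smul]

/-- In `⟪K f, J g⟫` the weights combine to `r A B = C r φ' = (r ∘ φ) φ'`, exactly the factor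
absorbed by the substitution `φ`. -/
theorem IsWeightedComposition.adjoint_apply_eq_self (h : IsCoefficients a b p q r)
    (D : IsDiffeo a b φ φ' ψ) {K J : L2 a b r →L[ℂ] L2 a b r}
    (hK : IsWeightedComposition A φ K) (hJ : IsWeightedComposition B φ J)
    (hAB : ∀ x ∈ openI a b, A x * B x = C * φ' x)
    (hr : ∀ᵐ x ∂(volume.restrict (openI a b)), r (φ x) = C * r x) (g : L2 a b r) :
    ContinuousLinearMap.adjoint K (J g) = g := by
  refine ext_inner_left ℂ fun f => ?_
  rw [ContinuousLinearMap.adjoint_inner_right, inner_L2_eq_integral, inner_L2_eq_integral,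
    h.integral_weight, h.integral_weight,
    ← D.setIntegral_comp (fun x => (r x : ℂ) * (g x * starRingEnd ℂ (f x)))]
  refine integral_congr_ae ?_
  filter_upwards [h.ae_weight_iff.1 (hK f), h.ae_weight_iff.1 (hJ g), hr, ae_mem_openI]
    with x h1 h2 h3 h4
  have h5 : (A x : ℂ) * B x = C * φ' x := by exact_mod_cast hAB x h4
  rw [h1, h2, h3, Complex.real_smul, Complex.real_smul, map_mul, Complex.conj_ofReal]
  push_cast
  linear_combination (r x : ℂ) * (g (φ x)) * (starRingEnd ℂ (f (φ x))) * h5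

theorem IsWeightedComposition.mem_compactlySupported (h : IsCoefficients a b p q r)
    (D : IsDiffeo a b φ φ' ψ) {K : L2 a b r →L[ℂ] L2 a b r} (hK : IsWeightedComposition A φ K)
    {f : L2 a b r} (hf : f ∈ compactlySupported a b r) : K f ∈ compactlySupported a b r := by
  obtain ⟨S, hS, hSI, hfS⟩ := hf
  refine ⟨ψ '' S, hS.image_of_continuousOn (D.symm.continuousOn.mono hSI),
    (image_mono hSI).trans D.mapsTo_inv.image_subset, ?_⟩
  filter_upwards [hK f, h.ae_comp D hfS, h.ae_weight_iff.2 ae_mem_openI] with x h1 h2 h3 h4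
  rw [h1, h2 fun h5 => h4 ⟨φ x, h5, D.left_inv x h3⟩, smul_zero]

end WeightedComposition

/-! ### Symmetries of the differential expression and the intertwining relation. -/

theorem ACLoc.ae_differentiableAt_real {a b : EReal} {y : ℝ → ℝ} (h : ACLoc (openI a b) y) :
    ∀ᵐ x ∂(volume.restrict (openI a b)), DifferentiableAt ℝ y x :=
  ae_restrict_openI_of_rat fun c hc d hd => (h c hc d hd).ae_differentiableAt

theorem ACLoc.continuousOn_real {a b : EReal} {y : ℝ → ℝ} (h : ACLoc (openI a b) y) :
    ContinuousOn y (openI a b) := by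
  have hy : ACLoc (openI a b) fun x => (y x : ℂ) := fun c hc d hd => (h c hc d hd).ofReal
  exact Complex.continuous_re.comp_continuousOn hy.continuousOn

/-- The transformation `f ↦ A (f ∘ φ)` on the open interval, with the functional equations
expressed through `φ` instead of its inverse `ψ`. -/
structure IsSymmetry (a b : EReal) (p q r A A₁ φ φ' ψ : ℝ → ℝ) (C : ℝ) : Prop
    extends IsDiffeo a b φ φ' ψ where
  C_pos : 0 < C
  ac_A : ACLoc (openI a b) A
  ac_A₁ : ACLoc (openI a b) A₁
  quasiDeriv : IsQuasiDeriv a b p A A₁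
  A_ne_zero : ∀ x ∈ openI a b, A x ≠ 0
  bdd : BddAbove ((fun x => A x ^ 2 / φ' x) '' openI a b)
  bdd_inv : BddAbove ((fun x => φ' x / A x ^ 2) '' openI a b)
  eq_r : ∀ᵐ x ∂(volume.restrict (openI a b)), r (φ x) = C * r x
  eq_p : ∀ᵐ x ∂(volume.restrict (openI a b)), p (φ x) = A x ^ 2 * φ' x * p x
  eq_q : ∀ᵐ x ∂(volume.restrict (openI a b)),
    q (φ x) = A x / φ' x * (A x * q x - deriv A₁ x)

namespace IsSymmetry

variable {a b : EReal} {p q r A A₁ φ φ' ψ : ℝ → ℝ} {C : ℝ}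

/-- The sign and shape of the new quasi-derivative come from `p = (A² φ' p) ∘ ψ`: multiplying `(1 /
(A ∘ ψ))' = -(A' / (A² φ')) ∘ ψ` by it leaves `-(p A') ∘ ψ`. -/
theorem symm (S : IsSymmetry a b p q r A A₁ φ φ' ψ C) :
    IsSymmetry a b p q r (fun x => (A (ψ x))⁻¹) (fun x => -A₁ (ψ x)) ψ (fun x => (φ' (ψ x))⁻¹) φ
      C⁻¹ := by
  have D := S.toIsDiffeo.symm
  have hne : ∀ x ∈ openI a b, A (ψ x) ≠ 0 := fun x hx => S.A_ne_zero _ (D.mapsTo hx)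
  have hpos : ∀ x ∈ openI a b, 0 < φ' (ψ x) := fun x hx => S.deriv_pos _ (D.mapsTo hx)
  refine
    { toIsDiffeo := D
      C_pos := inv_pos.2 S.C_pos
      ac_A := fun c hc d hd => (D.acLoc_comp S.ac_A c hc d hd).inv_of_ne_zero
        fun x hx => hne x (uIcc_subset_openI hc hd hx)
      ac_A₁ := fun c hc d hd => (D.acLoc_comp S.ac_A₁ c hc d hd).fun_neg
      quasiDeriv := ?_
      A_ne_zero := fun x hx => inv_ne_zero (hne x hx)
      bdd := ?_
      bdd_inv := ?_
      eq_r := ?_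
      eq_p := ?_
      eq_q := ?_ }
  · filter_upwards [D.ae_comp S.quasiDeriv, D.ae_comp S.eq_p,
      D.ae_comp S.ac_A.ae_differentiableAt_real, ae_mem_openI] with x h1 h2 h3 h4
    have h5 := ((h3.hasDerivAt.comp x (D.hasDerivAt x h4)).inv (hne x h4)).deriv
    rw [S.right_inv x h4] at h2
    have hA := hne x h4
    have hφ := (hpos x h4).ne'
    change _ = p x • deriv (A ∘ ψ)⁻¹ x
    rw [h5, h1, h2]
    simp only [smul_eq_mul, Function.comp_apply]
    field_simp
  · refine S.bdd_inv.mono ?_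
    rintro _ ⟨x, hx, rfl⟩
    refine ⟨ψ x, D.mapsTo hx, ?_⟩
    simp [div_eq_mul_inv, mul_comm]
  · refine S.bdd.mono ?_
    rintro _ ⟨x, hx, rfl⟩
    refine ⟨ψ x, D.mapsTo hx, ?_⟩
    simp [div_eq_mul_inv, mul_comm]
  · filter_upwards [D.ae_comp S.eq_r, ae_mem_openI] with x h1 h2
    rw [S.right_inv x h2] at h1
    rw [h1, inv_mul_cancel_left₀ S.C_pos.ne']
  · filter_upwards [D.ae_comp S.eq_p, ae_mem_openI] with x h1 h2
    rw [S.right_inv x h2] at h1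
    have hA := hne x h2
    have hφ := (hpos x h2).ne'
    rw [h1]
    field_simp
  · filter_upwards [D.ae_comp S.eq_q, D.ae_comp S.ac_A₁.ae_differentiableAt_real, ae_mem_openI]
      with x h1 h2 h3
    rw [S.right_inv x h3] at h1
    have hA := hne x h3
    have hφ := (hpos x h3).ne'
    have h4 : deriv (fun x => -A₁ (ψ x)) x = -(deriv A₁ (ψ x) * (φ' (ψ x))⁻¹) :=
      ((h2.hasDerivAt.comp x (D.hasDerivAt x h3)).neg).deriv
    rw [h1, h4]
    field_simp
    ring

/-- Existence of `K` and of `J = (K*)⁻¹`, the weighted composition with `C φ' / A`. -/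
theorem exists_operators (S : IsSymmetry a b p q r A A₁ φ φ' ψ C) (h : IsCoefficients a b p q r) :
    (∃ K : L2 a b r →L[ℂ] L2 a b r, IsWeightedComposition A φ K) ∧
    ∃ J : L2 a b r →L[ℂ] L2 a b r, IsWeightedComposition (fun x => C * φ' x / A x) φ J := by
  refine ⟨h.exists_isWeightedComposition S.toIsDiffeo S.ac_A.continuousOn_real S.bdd S.C_pos
    S.eq_r, h.exists_isWeightedComposition S.toIsDiffeo ?_ ?_ S.C_pos S.eq_r⟩
  · exact (continuousOn_const.mul S.continuousOn_deriv).div S.ac_A.continuousOn_real S.A_ne_zero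
  · obtain ⟨M, hM⟩ := S.bdd_inv
    refine ⟨C ^ 2 * M, ?_⟩
    rintro _ ⟨x, hx, rfl⟩
    have h1 : φ' x / A x ^ 2 ≤ M := hM (mem_image_of_mem _ hx)
    have hφ := (S.deriv_pos x hx).ne'
    have hA := S.A_ne_zero x hx
    calc (C * φ' x / A x) ^ 2 / φ' x = C ^ 2 * (φ' x / A x ^ 2) := by field_simp
      _ ≤ C ^ 2 * M := by gcongr

/-- By the equation for `p`, `p A φ' (y' ∘ φ) = A⁻¹ (y₁ ∘ φ)`, whence the quasi-derivative of `A (y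
∘ φ)`. When that is differentiated, the two terms with `A' (y₁ ∘ φ) / A²` cancel. The equation for
`q` collects the rest into `(φ' / A) ((r τ y) ∘ φ)`, and dividing by `r` produces the factor `C φ' /
A` of `J`. -/
theorem tauRel_map (S : IsSymmetry a b p q r A A₁ φ φ' ψ C) (h : IsCoefficients a b p q r)
    {K J : L2 a b r →L[ℂ] L2 a b r} (hK : IsWeightedComposition A φ K)
    (hJ : IsWeightedComposition (fun x => C * φ' x / A x) φ J) {f g : L2 a b r}
    (hfg : TauRel a b p q r f g) : TauRel a b p q r (K f) (J g) := by
  obtain ⟨y, y₁, hf, hy, hy₁, hq, hg⟩ := hfg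
  have D := S.toIsDiffeo
  have hyφ := D.acLoc_comp hy
  have hy₁φ := D.acLoc_comp hy₁
  have hinv : ACLoc (openI a b) fun x => (A x)⁻¹ := fun c hc d hd =>
    (S.ac_A c hc d hd).inv_of_ne_zero fun x hx => S.A_ne_zero x (uIcc_subset_openI hc hd hx)
  have hA₁ : ∀ᵐ x ∂(volume.restrict (openI a b)), A₁ x = p x * deriv A x := S.quasiDeriv
  have hquasi := D.ae_comp hq
  refine ⟨fun x => A x * y (φ x), fun x => A₁ x * y (φ x) + ((A x)⁻¹ : ℝ) * y₁ (φ x),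
    ?_, ?_, ?_, ?_, ?_⟩
  · filter_upwards [hK f, h.ae_comp D hf] with x h1 h2
    rw [h1, h2, Complex.real_smul]
  · exact fun c hc d hd => (S.ac_A c hc d hd).ofReal.fun_smul (hyφ c hc d hd)
  · exact fun c hc d hd => ((S.ac_A₁ c hc d hd).ofReal.fun_smul (hyφ c hc d hd)).fun_add
      ((hinv c hc d hd).ofReal.fun_smul (hy₁φ c hc d hd))
  · filter_upwards [hquasi, S.eq_p, hA₁, S.ac_A.ae_differentiableAt_real,
      D.ae_comp hy.ae_differentiableAt, ae_mem_openI] with x h1 h2 h3 h4 h5 h6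
    have hd := (h4.hasDerivAt.ofReal_comp.mul
      (h5.hasDerivAt.scomp x (D.hasDerivAt x h6))).deriv
    have hA : (A x : ℂ) ≠ 0 := by exact_mod_cast S.A_ne_zero x h6
    change _ = p x • deriv ((fun x => (A x : ℂ)) * (y ∘ φ)) x
    rw [hd, h1, h2, h3]
    simp only [Complex.real_smul, Function.comp_apply]
    push_cast
    field_simp
  · filter_upwards [hJ g, h.ae_comp D hg, h.ae_weight_iff.2 h.r_pos, h.ae_weight_iff.2 S.eq_r,
      h.ae_weight_iff.2 S.eq_q, h.ae_weight_iff.2 S.eq_p, h.ae_weight_iff.2 hA₁,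
      h.ae_weight_iff.2 hquasi, h.ae_weight_iff.2 S.ac_A.ae_differentiableAt_real,
      h.ae_weight_iff.2 S.ac_A₁.ae_differentiableAt_real,
      h.ae_comp D (h.ae_weight_iff.2 hy.ae_differentiableAt),
      h.ae_comp D (h.ae_weight_iff.2 hy₁.ae_differentiableAt), h.ae_weight_iff.2 ae_mem_openI]
      with x eJ eg hr er eq ep eA₁ eq₁ dA dA₁ dy dy₁ hx
    have hd := ((dA₁.hasDerivAt.ofReal_comp.mul (dy.hasDerivAt.scomp x (D.hasDerivAt x hx))).add
      ((dA.hasDerivAt.inv (S.A_ne_zero x hx)).ofReal_comp.mul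
        (dy₁.hasDerivAt.scomp x (D.hasDerivAt x hx)))).deriv
    have hA : (A x : ℂ) ≠ 0 := by exact_mod_cast S.A_ne_zero x hx
    have hφ : (φ' x : ℂ) ≠ 0 := by exact_mod_cast (S.deriv_pos x hx).ne'
    have hC : (C : ℂ) ≠ 0 := by exact_mod_cast S.C_pos.ne'
    have hr' : (r x : ℂ) ≠ 0 := by exact_mod_cast hr.ne'
    have hd' : deriv (fun x => (A₁ x : ℂ) * y (φ x) + ((A x)⁻¹ : ℝ) * y₁ (φ x)) x = _ := hd
    rw [eJ, eg, hd', er, eq]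
    simp only [Complex.real_smul, Function.comp_apply, Pi.inv_apply, eq₁, ep, eA₁]
    push_cast
    field_simp
    ring

theorem comp_symm_eq_self (S : IsSymmetry a b p q r A A₁ φ φ' ψ C) (h : IsCoefficients a b p q r)
    {K K' : L2 a b r →L[ℂ] L2 a b r} (hK : IsWeightedComposition A φ K)
    (hK' : IsWeightedComposition (fun x => (A (ψ x))⁻¹) ψ K') (f : L2 a b r) : K (K' f) = f :=
  hK.comp_eq_self h S.toIsDiffeo hK'
    (fun x hx => by rw [S.left_inv x hx, mul_inv_cancel₀ (S.A_ne_zero x hx)]) f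

theorem symm_comp_eq_self (S : IsSymmetry a b p q r A A₁ φ φ' ψ C) (h : IsCoefficients a b p q r)
    {K K' : L2 a b r →L[ℂ] L2 a b r} (hK : IsWeightedComposition A φ K)
    (hK' : IsWeightedComposition (fun x => (A (ψ x))⁻¹) ψ K') (f : L2 a b r) : K' (K f) = f :=
  hK'.comp_eq_self h S.toIsDiffeo.symm hK
    (fun _ hx => inv_mul_cancel₀ (S.symm.toIsDiffeo.mapsTo hx |> S.A_ne_zero _)) f

theorem kInvariant (S : IsSymmetry a b p q r A A₁ φ φ' ψ C) (h : IsCoefficients a b p q r)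
    {K : L2 a b r →L[ℂ] L2 a b r} (hK : IsWeightedComposition A φ K) :
    KInvariant K (Tmin0 a b p q r) ∧ KInvariant K (Tmin a b p q r) ∧
      KInvariant K (Tmax a b p q r) := by
  obtain ⟨-, J, hJ⟩ := S.exists_operators h
  obtain ⟨⟨K', hK'⟩, J', hJ'⟩ := S.symm.exists_operators h
  have hKK' := S.comp_symm_eq_self h hK hK'
  have hK'K := S.symm_comp_eq_self h hK hK'
  have hunit : IsUnit K :=
    ⟨⟨K, K', ContinuousLinearMap.ext hKK', ContinuousLinearMap.ext hK'K⟩, rfl⟩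
  have hadj := hK.adjoint_apply_eq_self h S.toIsDiffeo hJ
    (fun x hx => mul_div_cancel₀ _ (S.A_ne_zero x hx)) S.eq_r
  have hd := dense_domain_Tmin0 h
  have hmax : (Tmax a b p q r).IsClosable := isClosable_Tmax h hd
  have hmin0 : (Tmin0 a b p q r).IsClosable := hmax.leIsClosable Tmin0_le_Tmax
  have m1 : ∀ f g, (f, g) ∈ (Tmin0 a b p q r).graph → (K f, J g) ∈ (Tmin0 a b p q r).graph := by
    intro f g hfg
    rw [mem_graph_Tmin0 h] at hfg ⊢
    exact ⟨S.tauRel_map h hK hJ hfg.1, hK.mem_compactlySupported h S.toIsDiffeo hfg.2⟩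
  have m2 : ∀ f g, (f, g) ∈ (Tmin0 a b p q r).graph →
      (K' f, J' g) ∈ (Tmin0 a b p q r).graph := by
    intro f g hfg
    rw [mem_graph_Tmin0 h] at hfg ⊢
    exact ⟨S.symm.tauRel_map h hK' hJ' hfg.1,
      hK'.mem_compactlySupported h S.symm.toIsDiffeo hfg.2⟩
  refine ⟨⟨hunit, hd, hmin0, conjOp_eq_of_graph_maps hK'K hadj m1 m2⟩,
    ⟨hunit, hd.mono (LinearPMap.le_closure _).1, hmin0.closureIsClosable,
      conjOp_eq_of_graph_maps hK'K hadj (graph_closure_maps hmin0 m1)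
        (graph_closure_maps hmin0 m2)⟩,
    ⟨hunit, hd.mono Tmin0_le_Tmax.1, hmax, conjOp_eq_of_graph_maps (J' := J') hK'K hadj ?_ ?_⟩⟩
  · intro f g hfg
    rw [mem_graph_Tmax h] at hfg ⊢
    exact S.tauRel_map h hK hJ hfg
  · intro f g hfg
    rw [mem_graph_Tmax h] at hfg ⊢
    exact S.symm.tauRel_map h hK' hJ' hfg

end IsSymmetry

/-! ### Endpoint behaviour of `φ`. -/

theorem openI_subset_closedI (a b : EReal) : openI a b ⊆ closedI a b :=
  fun _ hx => ⟨hx.1.le, hx.2.le⟩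

theorem convex_closedI (a b : EReal) : Convex ℝ (closedI a b) := by
  refine OrdConnected.convex ⟨fun x hx y hy z hz => ⟨hx.1.trans ?_, le_trans ?_ hy.2⟩⟩
  · exact_mod_cast hz.1
  · exact_mod_cast hz.2

theorem interior_closedI_subset (a b : EReal) : interior (closedI a b) ⊆ openI a b := by
  intro x hx
  obtain ⟨ε, hε, hb⟩ := Metric.isOpen_iff.1 isOpen_interior x hx
  have h1 : x - ε / 2 ∈ closedI a b :=
    interior_subset (hb (by rw [Real.ball_eq_Ioo]; constructor <;> linarith))
  have h2 : x + ε / 2 ∈ closedI a b :=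
    interior_subset (hb (by rw [Real.ball_eq_Ioo]; constructor <;> linarith))
  refine ⟨h1.1.trans_lt ?_, lt_of_lt_of_le ?_ h2.2⟩ <;> exact_mod_cast (by linarith)

section Endpoints

variable {a b : EReal} {φ : ℝ → ℝ}

theorem FixesEndpoints.exists_lt (hfix : FixesEndpoints a b φ)
    (hc : ContinuousOn φ (closedI a b)) {y : ℝ} (hy : a < y) {x₀ : ℝ} (hx₀ : x₀ ∈ openI a b) :
    ∃ x ∈ openI a b, x < x₀ ∧ φ x < y := by
  induction a with
  | bot =>
    obtain ⟨x, h1, h2⟩ := (((hfix.2.1 rfl).eventually_lt_atBot y).and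
      (eventually_lt_atBot x₀)).exists
    exact ⟨x, ⟨EReal.bot_lt_coe x, lt_trans (by exact_mod_cast h2) hx₀.2⟩, h2, h1⟩
  | coe a' =>
    have ha : a' < x₀ := by exact_mod_cast hx₀.1
    have hmem : a' ∈ closedI (a' : EReal) b := ⟨le_rfl, (hx₀.1.trans hx₀.2).le⟩
    have hsub : Ioo a' x₀ ⊆ openI (a' : EReal) b := fun x hx =>
      ⟨by exact_mod_cast hx.1, lt_trans (by exact_mod_cast hx.2) hx₀.2⟩
    have hlim : Tendsto φ (𝓝[Ioo a' x₀] a') (𝓝 a') := by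
      have := (hc a' hmem).mono (hsub.trans (openI_subset_closedI _ _))
      rwa [ContinuousWithinAt, hfix.1 a' (Or.inl rfl)] at this
    have : (𝓝[Ioo a' x₀] a').NeBot := left_nhdsWithin_Ioo_neBot ha
    obtain ⟨x, h1, h2⟩ := ((hlim.eventually (gt_mem_nhds (by exact_mod_cast hy))).and
      eventually_mem_nhdsWithin).exists
    exact ⟨x, hsub h2, h2.2, h1⟩
  | top => exact absurd hy not_top_lt

theorem FixesEndpoints.exists_gt (hfix : FixesEndpoints a b φ)
    (hc : ContinuousOn φ (closedI a b)) {y : ℝ} (hy : (y : EReal) < b) {x₀ : ℝ}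
    (hx₀ : x₀ ∈ openI a b) : ∃ x ∈ openI a b, x₀ < x ∧ y < φ x := by
  induction b with
  | top =>
    obtain ⟨x, h1, h2⟩ := (((hfix.2.2 rfl).eventually_gt_atTop y).and
      (eventually_gt_atTop x₀)).exists
    exact ⟨x, ⟨hx₀.1.trans (by exact_mod_cast h2), EReal.coe_lt_top x⟩, h2, h1⟩
  | coe b' =>
    have hb : x₀ < b' := by exact_mod_cast hx₀.2
    have hmem : b' ∈ closedI a (b' : EReal) := ⟨(hx₀.1.trans hx₀.2).le, le_rfl⟩
    have hsub : Ioo x₀ b' ⊆ openI a (b' : EReal) := fun x hx =>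
      ⟨hx₀.1.trans (by exact_mod_cast hx.1), by exact_mod_cast hx.2⟩
    have hlim : Tendsto φ (𝓝[Ioo x₀ b'] b') (𝓝 b') := by
      have := (hc b' hmem).mono (hsub.trans (openI_subset_closedI _ _))
      rwa [ContinuousWithinAt, hfix.1 b' (Or.inr rfl)] at this
    have : (𝓝[Ioo x₀ b'] b').NeBot := right_nhdsWithin_Ioo_neBot hb
    obtain ⟨x, h1, h2⟩ := ((hlim.eventually (lt_mem_nhds (by exact_mod_cast hy))).and
      eventually_mem_nhdsWithin).exists
    exact ⟨x, hsub h2, h2.1, h1⟩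
  | bot => exact absurd hy not_lt_bot

theorem FixesEndpoints.mapsTo (hfix : FixesEndpoints a b φ)
    (hm : StrictMonoOn φ (closedI a b)) : MapsTo φ (openI a b) (openI a b) := by
  intro x hx
  have hx' := openI_subset_closedI _ _ hx
  constructor
  · induction a with
    | bot => exact EReal.bot_lt_coe _
    | coe a' =>
      have := hm (a := a') ⟨le_rfl, (hx.1.trans hx.2).le⟩ hx' (by exact_mod_cast hx.1)
      rw [hfix.1 a' (Or.inl rfl)] at this
      exact_mod_cast this
    | top => exact absurd hx.1 not_top_lt
  · induction b with
    | top => exact EReal.coe_lt_top _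
    | coe b' =>
      have := hm hx' (b := b') ⟨(hx.1.trans hx.2).le, le_rfl⟩ (by exact_mod_cast hx.2)
      rw [hfix.1 b' (Or.inr rfl)] at this
      exact_mod_cast this
    | bot => exact absurd hx.2 not_lt_bot

theorem FixesEndpoints.surjOn (hab : a < b) (hfix : FixesEndpoints a b φ)
    (hc : ContinuousOn φ (closedI a b)) : SurjOn φ (openI a b) (openI a b) := by
  intro y hy
  obtain ⟨x₀, h1, h2⟩ := EReal.lt_iff_exists_real_btwn.1 hab
  obtain ⟨c, hcI, -, hcy⟩ := hfix.exists_lt hc hy.1 ⟨h1, h2⟩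
  obtain ⟨d, hdI, -, hdy⟩ := hfix.exists_gt hc hy.2 ⟨h1, h2⟩
  have hpre := (ordConnected_openI a b).isPreconnected.image φ
    (hc.mono (openI_subset_closedI a b))
  exact hpre.Icc_subset (mem_image_of_mem φ hcI) (mem_image_of_mem φ hdI) ⟨hcy.le, hdy.le⟩

/-- If `φ x₀ > a`, values of `φ` near `a` drop below `φ x₀` to the left of `x₀`. Otherwise `φ x₀ <
b`, and values near `b` exceed it to the right. Both contradict decrease, and `φ x₀` need not be
known to lie in `(a, b)`. -/
theorem FixesEndpoints.not_strictAntiOn (hab : a < b) (hfix : FixesEndpoints a b φ)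
    (hc : ContinuousOn φ (closedI a b)) : ¬StrictAntiOn φ (openI a b) := by
  intro hanti
  obtain ⟨x₀, h1, h2⟩ := EReal.lt_iff_exists_real_btwn.1 hab
  have hx₀ : x₀ ∈ openI a b := ⟨h1, h2⟩
  rcases lt_or_ge a (φ x₀ : EReal) with h | h
  · obtain ⟨x, hx, hlt, hφ⟩ := hfix.exists_lt hc h hx₀
    exact (hφ.trans (hanti hx hx₀ hlt)).false
  · obtain ⟨x, hx, hlt, hφ⟩ := hfix.exists_gt hc (h.trans_lt hab) hx₀
    exact (hφ.trans (hanti hx₀ hx hlt)).false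

end Endpoints

/-! ### From the hypotheses on `A` and `φ` to a symmetry. -/

section Transformation

variable {a b : EReal} {p q r A A₁ φ : ℝ → ℝ} {C : ℝ}

theorem IsTransformation.isDiffeo (hab : a < b) (h : IsTransformation a b p A A₁ φ) :
    IsDiffeo a b φ (deriv φ) (phiInv a b φ) := by
  have hIo := isOpen_openI a b
  have hsub := openI_subset_closedI a b
  have hc := h.contDiffOn.continuousOn
  have hφ : ContDiffOn ℝ 2 φ (openI a b) := h.contDiffOn.mono hsub
  have hd : ∀ x ∈ openI a b, HasDerivAt φ (deriv φ x) x := fun x hx =>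
    ((hφ.contDiffAt (hIo.mem_nhds hx)).differentiableAt (by norm_num)).hasDerivAt
  have hne : ∀ x ∈ openI a b, deriv φ x ≠ 0 := fun x hx => by
    rw [← derivWithin_of_mem_nhds (mem_of_superset (hIo.mem_nhds hx) hsub)]
    exact h.deriv_ne_zero x (hsub hx)
  have hpos : ∀ x ∈ openI a b, 0 < deriv φ x := by
    -- Darboux: a nowhere vanishing derivative has constant sign, and the fixed endpoints exclude
    -- the negative one.
    refine (hasDerivWithinAt_forall_lt_or_forall_gt_of_forall_ne (ordConnected_openI a b).convex
      (fun x hx => (hd x hx).hasDerivWithinAt) hne).resolve_left fun hneg => ?_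
    refine h.fixes.not_strictAntiOn hab hc
      (strictAntiOn_of_deriv_neg (ordConnected_openI a b).convex (hc.mono hsub) ?_)
    rwa [hIo.interior_eq]
  have hm : StrictMonoOn φ (closedI a b) := strictMonoOn_of_deriv_pos (convex_closedI a b) hc
    fun x hx => hpos x (interior_closedI_subset a b hx)
  have hs := h.fixes.surjOn hab hc
  exact
    { mapsTo := h.fixes.mapsTo hm
      mapsTo_inv := hs.mapsTo_invFunOn
      left_inv := fun x hx => (hm.injOn.mono hsub).leftInvOn_invFunOn hx
      right_inv := fun x hx => hs.rightInvOn_invFunOn hx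
      hasDerivAt := hd
      deriv_pos := hpos
      continuousOn_deriv := hφ.continuousOn_deriv_of_isOpen hIo (by norm_num) }

/-- Composing the a.e. equations with `φ`, which preserves null sets under preimage, replaces `φ⁻¹
(φ x)` by `x`. -/
theorem IsTransformation.isSymmetry (hab : a < b) (hC : 0 < C)
    (h : IsTransformation a b p A A₁ φ) (heq : FunctionalEquations a b p q r A A₁ φ C) :
    IsSymmetry a b p q r A A₁ φ (deriv φ) (phiInv a b φ) C := by
  have D := h.isDiffeo hab
  have hsub := openI_subset_closedI a b
  refine
    { toIsDiffeo := D
      C_pos := hC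
      ac_A := fun c hc d hd => h.ac_A c (hsub hc) d (hsub hd)
      ac_A₁ := fun c hc d hd => h.ac_A₁ c (hsub hc) d (hsub hd)
      quasiDeriv := h.quasiDeriv
      A_ne_zero := h.A_ne_zero
      bdd := h.bdd
      bdd_inv := h.bdd_inv
      eq_r := ?_
      eq_p := ?_
      eq_q := ?_ }
  · filter_upwards [D.ae_comp heq.eq_r, ae_mem_openI] with x h1 h2
    rwa [D.left_inv x h2] at h1
  · filter_upwards [D.ae_comp heq.eq_p, ae_mem_openI] with x h1 h2
    rwa [D.left_inv x h2] at h1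
  · filter_upwards [D.ae_comp heq.eq_q, ae_mem_openI] with x h1 h2
    rwa [D.left_inv x h2] at h1

end Transformation

end SturmLiouville

open SturmLiouville in
theorem mainTheorem4 (a b : EReal) (p q r A A₁ φ : ℝ → ℝ) (C : ℝ)
    (hcoeff : IsCoefficients a b p q r) (hC : 0 < C)
    (htrans : IsTransformation a b p A A₁ φ)
    (heq : FunctionalEquations a b p q r A A₁ φ C) :
    (∃! K : L2 a b r →L[ℂ] L2 a b r, IsWeightedComposition A φ K) ∧
    ∀ K : L2 a b r →L[ℂ] L2 a b r, IsWeightedComposition A φ K →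
      KInvariant K (Tmin0 a b p q r) ∧
      KInvariant K (Tmin a b p q r) ∧
      KInvariant K (Tmax a b p q r) := by
  have S := htrans.isSymmetry hcoeff.lt hC heq
  obtain ⟨⟨K, hK⟩, -⟩ := S.exists_operators hcoeff
  exact ⟨⟨K, hK, fun K' hK' => hK'.unique hK⟩, fun K hK => S.kInvariant hcoeff hK⟩
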